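/- Let $H$ be a complex Hilbert space and $I=[0,1]$. Let $\mathcal{CF}^{sa}(H)$ be the set of all densely defined selfadjoint operators $T:\mathcal D(T)\subset H\to H$ that are Fredholm (i.e. $\dim\ker T<\infty$ and $\operatorname{codim}\operatorname{im}T<\infty$), with the gap metric $d_G(S,T)=\|\kappa(S)-\kappa(T)\|$, where $\kappa(T)=(T-i)(T+i)^{-1}$ is the Cayley transform. Write $\rho(T)$ for the resolvent set and $\sigma_{ess}(T)$ for the set of all $\lambda\in\mathbb C$ such that $\lambda-T$ is not Fredholm. For a gap-continuous path $\mathcal A:I\to\mathcal{CF}^{sa}(H)$ the spectral flow is $$\operatorname{sf}(\mathcal A)=\sum_{i=1}^n\bigl(\dim E_{[0,a_i]}(\mathcal A_{\lambda_i})-\dim E_{[0,a_i]}(\mathcal A_{\lambda_{i-1}})\bigr)\in\mathbb Z,\qquad E_{[c,d]}(T)=\bigoplus_{\mu\in[c,d]}\ker(\mu-T),$$ where $0=\lambda_0\le\lambda_1\le\dots\le\lambda_n=1$ and $a_1,\dots,a_n>0$ are any numbers such that, for each $i$ and all $\lambda\in[\lambda_{i-1},\lambda_i]$, one has $\pm a_i\in\rho(\mathcal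 A_\lambda)$ and $[-a_i,a_i]\cap\sigma_{ess}(\mathcal A_\lambda)=\emptyset$, and the spectral projections $\chi_{[-a_i,a_i]}(\mathcal A_\lambda)=\frac1{2\pi i}\oint_{|z|=a_i}(z-\mathcal A_\lambda)^{-1}\,dz$ depend continuously on $\lambda\in[\lambda_{i-1},\lambda_i]$ in operator norm and have the same finite rank. Let $h:I\times I\to\mathcal{CF}^{sa}(H)$ be continuous with respect to the gap metric, and assume that for every $s\in I$ the operators $h(s,0)$ and $h(s,1)$ are invertible, i.e. map their domains bijectively onto $H$. Then the spectral flows of the paths $h(0,\cdot)$ and $h(1,\cdot)$ are well defined (the numbers $\lambda_i,a_i$ exist, and the sum does not depend on their choice), and $$\operatorname{sf}(h(0,\cdot))=\operatorname{sf}(h(1,\cdot)).$$ -/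

import Mathlib

/-! Unbounded operators on a complex Hilbert space `H` are partially defined linear maps
`T : H →ₗ.[ℂ] H` with domain `T.domain`. -/

namespace SpecFlow

open Complex Set

noncomputable section

section Operators

variable {H : Type*} [NormedAddCommGroup H] [InnerProductSpace ℂ H]

/-- The operator `z - T`, with the same domain as `T`. -/
def scalarSub (z : ℂ) (T : H →ₗ.[ℂ] H) : H →ₗ.[ℂ] H where
  domain := T.domain
  toFun := z • T.domain.subtype - T.toFun

/-- `T` is invertible: it maps its domain bijectively onto `H`. -/
def IsInvertible (T : H →ₗ.[ℂ] H) : Prop :=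
  Function.Bijective (fun x : T.domain => T x)

/-- `R` is a bounded, everywhere defined two-sided inverse of the operator `T`. -/
def IsBoundedInverse (R : H →L[ℂ] H) (T : H →ₗ.[ℂ] H) : Prop :=
  (∀ x : T.domain, R (T x) = x) ∧ ∀ y : H, ∃ x : T.domain, (x : H) = R y ∧ T x = y

/-- The resolvent set `ρ(T)`: all `z` such that `z - T` has a bounded inverse. -/
def resolventSet (T : H →ₗ.[ℂ] H) : Set ℂ :=
  {z | ∃ R : H →L[ℂ] H, IsBoundedInverse R (scalarSub z T)}

open Classical in
/-- The resolvent `(z - T)⁻¹` as a bounded operator for `z ∈ ρ(T)` (and `0` for other `z`). -/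
def resolvent (T : H →ₗ.[ℂ] H) (z : ℂ) : H →L[ℂ] H :=
  if hz : z ∈ resolventSet T then hz.choose else 0

/-- `T` is Fredholm: closed, with finite-dimensional kernel and range of finite codimension. -/
def IsFredholm (T : H →ₗ.[ℂ] H) : Prop :=
  T.IsClosed ∧ FiniteDimensional ℂ (LinearMap.ker T.toFun) ∧
    FiniteDimensional ℂ (H ⧸ LinearMap.range T.toFun)

/-- The essential spectrum: all `z` such that `z - T` is not Fredholm. -/
def essSpectrum (T : H →ₗ.[ℂ] H) : Set ℂ :=
  {z | ¬ IsFredholm (scalarSub z T)}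

/-- The space `ker (μ - T)`, as a subspace of `H`. -/
def eigenspace (T : H →ₗ.[ℂ] H) (μ : ℝ) : Submodule ℂ H :=
  (LinearMap.ker (scalarSub (μ : ℂ) T).toFun).map T.domain.subtype

/-- `E_{[c,d]}(T)`, the sum of the spaces `ker (μ - T)` over all `μ ∈ [c,d]`. -/
def eigenspaceSum (T : H →ₗ.[ℂ] H) (c d : ℝ) : Submodule ℂ H :=
  ⨆ μ ∈ Icc c d, eigenspace T μ

/-- The spectral projection `χ_{[c,d]}(T) = (2πi)⁻¹ ∮ (z - T)⁻¹ dz`, the integral being over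
the circle with centre `(c+d)/2` and radius `(d-c)/2`. -/
def spectralProj (T : H →ₗ.[ℂ] H) (c d : ℝ) : H →L[ℂ] H :=
  (2 * Real.pi * I : ℂ)⁻¹ •
    circleIntegral (fun z => resolvent T z) (((c + d) / 2 : ℝ) : ℂ) ((d - c) / 2)

/-- The Cayley transform `κ(T) = (T - i)(T + i)⁻¹ = 1 - 2i (T + i)⁻¹`, where
`(T + i)⁻¹ = - ((-i) - T)⁻¹`. -/
def cayley (T : H →ₗ.[ℂ] H) : H →L[ℂ] H :=
  1 + (2 * I) • resolvent T (-I)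

theorem resolvent_spec {T : H →ₗ.[ℂ] H} {z : ℂ} (hz : z ∈ resolventSet T) :
    IsBoundedInverse (resolvent T z) (scalarSub z T) := by
  rw [resolvent, dif_pos hz]
  exact hz.choose_spec

theorem IsBoundedInverse.unique {R R' : H →L[ℂ] H} {T : H →ₗ.[ℂ] H}
    (h : IsBoundedInverse R T) (h' : IsBoundedInverse R' T) : R = R' := by
  ext y
  obtain ⟨x, hx, rfl⟩ := h.2 y
  rw [h.1, h'.1]

end Operators

section SelfAdjoint

variable {H : Type*} [NormedAddCommGroup H] [InnerProductSpace ℂ H] [CompleteSpace H]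

theorem inner_symm_of_isSelfAdjoint {T : H →ₗ.[ℂ] H} (hT : IsSelfAdjoint T) (x y : T.domain) :
    inner ℂ (T x) (y : H) = inner ℂ (x : H) (T y) := by
  have h := LinearPMap.adjoint_isFormalAdjoint (T := T) hT.dense_domain
  rw [LinearPMap.isSelfAdjoint_def.mp hT] at h
  exact h x y

theorem norm_scalarSub_sq {T : H →ₗ.[ℂ] H} (hT : IsSelfAdjoint T) (x : T.domain) :
    ‖scalarSub (-I) T x‖ ^ 2 = ‖(x : H)‖ ^ 2 + ‖T x‖ ^ 2 := by
  have h1 : scalarSub (-I) T x = (-I) • (x : H) - T x := rfl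
  have him : (inner ℂ (x : H) (T x)).im = 0 := by
    have := inner_symm_of_isSelfAdjoint hT x x
    rw [← inner_conj_symm] at this
    exact Complex.conj_eq_iff_im.mp this
  rw [h1, @norm_sub_sq ℂ, inner_smul_left, norm_smul]
  simp [him]

/-- For a selfadjoint operator `T`, the operator `T + i` has a bounded inverse. -/
theorem neg_I_mem_resolventSet {T : H →ₗ.[ℂ] H} (hT : IsSelfAdjoint T) :
    -I ∈ resolventSet T := by
  set S := scalarSub (-I) T with hS
  have hSx : ∀ x : T.domain, S x = (-I) • (x : H) - T x := fun _ => rfl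
  have hb : ∀ x : T.domain, ‖(x : H)‖ ≤ ‖S x‖ ∧ ‖T x‖ ≤ ‖S x‖ := fun x => by
    have := norm_scalarSub_sq hT x
    constructor <;> refine abs_le_of_sq_le_sq' ?_ (norm_nonneg _) |>.2 <;>
      nlinarith [sq_nonneg ‖(x : H)‖, sq_nonneg ‖T x‖]
  have hinj : Function.Injective S.toFun := by
    rw [← LinearMap.ker_eq_bot, LinearMap.ker_eq_bot']
    intro x hx
    have h0 : ‖S x‖ = 0 := by rw [norm_eq_zero]; exact hx
    have := (hb x).1
    rw [h0] at this
    exact Subtype.ext (norm_le_zero_iff.mp this)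
  have hclosed : IsClosed (LinearMap.range S.toFun : Set H) := by
    have hc : IsClosed (T.graph : Set (H × H)) := hT.isClosed
    have : CompleteSpace T.graph := hc.completeSpace_coe
    let f : T.graph →L[ℂ] H :=
      ((-I) • ContinuousLinearMap.fst ℂ H H - ContinuousLinearMap.snd ℂ H H).comp T.graph.subtypeL
    have hf : AntilipschitzWith 1 f := by
      refine AddMonoidHomClass.antilipschitz_of_bound f ?_
      rintro ⟨p, hp⟩
      obtain ⟨x, rfl⟩ := LinearPMap.mem_graph_iff' _ |>.mp hp
      have := hb x
      simp only [NNReal.coe_one, one_mul]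
      exact max_le this.1 this.2
    have hr := hf.isClosed_range f.uniformContinuous
    convert hr using 1
    ext y
    constructor
    · rintro ⟨x, rfl⟩
      exact ⟨⟨_, T.mem_graph x⟩, rfl⟩
    · rintro ⟨⟨p, hp⟩, rfl⟩
      obtain ⟨x, rfl⟩ := LinearPMap.mem_graph_iff' _ |>.mp hp
      exact ⟨x, rfl⟩
  have hdense : (LinearMap.range S.toFun)ᗮ = ⊥ := by
    rw [Submodule.eq_bot_iff]
    intro y hy
    have hy' : ∀ x : T.domain, inner ℂ (I • y) (x : H) = inner ℂ y (T x) := fun x => by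
      have := (Submodule.mem_orthogonal' _ _).mp hy _ ⟨x, rfl⟩
      change inner ℂ y ((-I) • (x : H) - T x) = 0 at this
      rw [inner_sub_right, sub_eq_zero] at this
      rw [← this, inner_smul_left, inner_smul_right]
      simp
    have hmem : y ∈ T.adjoint.domain :=
      LinearPMap.mem_adjoint_domain_of_exists y ⟨I • y, hy'⟩
    have happ : T.adjoint ⟨y, hmem⟩ = I • y :=
      LinearPMap.adjoint_apply_eq hT.dense_domain ⟨y, hmem⟩ hy'
    have hsa := LinearPMap.isSelfAdjoint_def.mp hT
    have hg : (y, I • y) ∈ T.graph := by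
      have hg' : (y, I • y) ∈ T.adjoint.graph := by
        have := T.adjoint.mem_graph ⟨y, hmem⟩
        rwa [happ] at this
      rwa [hsa] at hg'
    obtain ⟨x, hx1, hx2⟩ := (LinearPMap.mem_graph_iff T).mp hg
    simp only at hx1 hx2
    have hsym := inner_symm_of_isSelfAdjoint hT x x
    rw [hx2, hx1, inner_smul_left, inner_smul_right, inner_self_eq_norm_sq_to_K] at hsym
    have h1 : (2 * I) * ((‖y‖ : ℂ) ^ 2) = 0 := by
      simp only [conj_I] at hsym
      have h2 : (-I) * ((‖y‖ : ℂ) ^ 2) = I * ((‖y‖ : ℂ) ^ 2) := hsym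
      linear_combination -h2
    simpa using h1
  have htop : LinearMap.range S.toFun = ⊤ := by
    have : CompleteSpace (LinearMap.range S.toFun) := hclosed.completeSpace_coe
    exact Submodule.orthogonal_eq_bot_iff.mp hdense
  let e := LinearEquiv.ofBijective S.toFun ⟨hinj, LinearMap.range_eq_top.mp htop⟩
  have he : ∀ x, e x = S x := fun _ => rfl
  refine ⟨LinearMap.mkContinuous (S.domain.subtype ∘ₗ e.symm.toLinearMap) 1 fun y => ?_, ?_, ?_⟩
  · rw [one_mul]
    have := (hb (e.symm y)).1
    rw [← he, e.apply_symm_apply] at this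
    exact this
  · intro x
    change ((e.symm (e x) : S.domain) : H) = x
    rw [e.symm_apply_apply]
  · intro y
    exact ⟨e.symm y, rfl, e.apply_symm_apply y⟩

/-- The Cayley transform of a selfadjoint operator `T` maps `T x + i x` to `T x - i x`. -/
theorem cayley_apply {T : H →ₗ.[ℂ] H} (hT : IsSelfAdjoint T) (x : T.domain) :
    cayley T (T x + I • (x : H)) = T x - I • (x : H) := by
  have h := (resolvent_spec (neg_I_mem_resolventSet hT)).1 x
  change resolvent T (-I) ((-I) • (x : H) - T x) = x at h
  have h2 : resolvent T (-I) (T x + I • (x : H)) = -(x : H) := by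
    rw [← h, ← map_neg]
    congr 1
    rw [h, neg_smul]
    abel
  simp only [cayley, add_apply, smul_apply, h2,
    one_apply_eq_self]
  module

variable (H) in
/-- The space of all (densely defined) selfadjoint operators on `H`. -/
structure SelfAdjointOp where
  /-- The underlying operator. -/
  op : H →ₗ.[ℂ] H
  /-- It equals its adjoint, which forces its domain to be dense. -/
  isSelfAdjoint : IsSelfAdjoint op

theorem cayley_injective :
    Function.Injective (fun T : SelfAdjointOp H => cayley T.op) := by
  rintro ⟨T, hT⟩ ⟨T', hT'⟩ h
  have h2I : (2 * I : ℂ) ≠ 0 := by simp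
  have hR : resolvent T (-I) = resolvent T' (-I) := by
    simpa [cayley, h2I] using h
  have key : ∀ {A B : H →ₗ.[ℂ] H}, IsSelfAdjoint A → IsSelfAdjoint B →
      resolvent A (-I) = resolvent B (-I) → A ≤ B := by
    intro A B hA hB hAB
    refine LinearPMap.le_of_le_graph ?_
    intro p hp
    obtain ⟨x, rfl⟩ := (LinearPMap.mem_graph_iff' _).mp hp
    have h1 := (resolvent_spec (neg_I_mem_resolventSet hA)).1 x
    obtain ⟨y, hy1, hy2⟩ := (resolvent_spec (neg_I_mem_resolventSet hB)).2
      (scalarSub (-I) A x)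
    rw [← hAB, h1] at hy1
    change (-I) • (y : H) - B y = (-I) • (x : H) - A x at hy2
    rw [hy1, sub_right_inj] at hy2
    rw [← hy1, ← hy2]
    exact B.mem_graph y
  have : T = T' := le_antisymm (key hT hT' hR) (key hT' hT hR.symm)
  subst this
  rfl

/-- The gap metric `d(S, T) = ‖κ(S) - κ(T)‖` on selfadjoint operators. -/
instance : MetricSpace (SelfAdjointOp H) :=
  MetricSpace.induced (fun T => cayley T.op) cayley_injective inferInstance

theorem gapDist_eq (S T : SelfAdjointOp H) : dist S T = ‖cayley S.op - cayley T.op‖ :=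
  dist_eq_norm (cayley S.op) (cayley T.op)

variable (H) in
/-- The space of selfadjoint Fredholm operators, with the gap metric. -/
abbrev FredholmSelfAdjointOp : Type _ :=
  {T : SelfAdjointOp H // IsFredholm T.op}

/-- The data entering the definition of the spectral flow of a path `A` of selfadjoint Fredholm
operators: a partition `0 = t₀ ≤ t₁ ≤ … ≤ tₙ = 1` and numbers `aᵢ > 0` such that, for all `s` in
the `i`-th subinterval, `±aᵢ ∈ ρ(A s)`, the interval `[-aᵢ, aᵢ]` does not meet the essential
spectrum of `A s`, and the spectral projections `χ_{[-aᵢ, aᵢ]}(A s)` depend continuously on `s`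
and have the same finite rank. -/
structure IsFlowPartition (A : unitInterval → FredholmSelfAdjointOp H) {n : ℕ}
    (t : Fin (n + 1) → unitInterval) (a : Fin n → ℝ) : Prop where
  mono : Monotone t
  zero : t 0 = 0
  last : t (Fin.last n) = 1
  pos : ∀ i, 0 < a i
  right_mem : ∀ i, ∀ s ∈ Icc (t i.castSucc) (t i.succ), ((a i : ℝ) : ℂ) ∈ resolventSet (A s).1.op
  left_mem : ∀ i, ∀ s ∈ Icc (t i.castSucc) (t i.succ),
    ((-(a i) : ℝ) : ℂ) ∈ resolventSet (A s).1.op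
  disj : ∀ i, ∀ s ∈ Icc (t i.castSucc) (t i.succ), ∀ μ ∈ Icc (-(a i)) (a i),
    (μ : ℂ) ∉ essSpectrum (A s).1.op
  cont : ∀ i, ContinuousOn (fun s => spectralProj (A s).1.op (-(a i)) (a i))
    (Icc (t i.castSucc) (t i.succ))
  finite_rank : ∀ i, ∀ s ∈ Icc (t i.castSucc) (t i.succ),
    FiniteDimensional ℂ (LinearMap.range (spectralProj (A s).1.op (-(a i)) (a i)).toLinearMap)
  const_rank : ∀ i, ∀ s ∈ Icc (t i.castSucc) (t i.succ), ∀ s' ∈ Icc (t i.castSucc) (t i.succ),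
    Module.finrank ℂ (LinearMap.range (spectralProj (A s).1.op (-(a i)) (a i)).toLinearMap) =
    Module.finrank ℂ (LinearMap.range (spectralProj (A s').1.op (-(a i)) (a i)).toLinearMap)

/-- `k` is the value `∑ᵢ (dim E_{[0,aᵢ]}(A tᵢ) - dim E_{[0,aᵢ]}(A tᵢ₋₁))` for some partition and
numbers as above. -/
def HasSpectralFlow (A : unitInterval → FredholmSelfAdjointOp H) (k : ℤ) : Prop :=
  ∃ (n : ℕ) (t : Fin (n + 1) → unitInterval) (a : Fin n → ℝ), IsFlowPartition A t a ∧
    k = ∑ i : Fin n,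
      ((Module.finrank ℂ (eigenspaceSum (A (t i.succ)).1.op 0 (a i)) : ℤ) -
        (Module.finrank ℂ (eigenspaceSum (A (t i.castSucc)).1.op 0 (a i)) : ℤ))

open Classical in
/-- The spectral flow of a path of selfadjoint Fredholm operators (`0` if no partition as above
exists, which happens only for discontinuous paths). -/
def spectralFlow (A : unitInterval → FredholmSelfAdjointOp H) : ℤ :=
  if hA : ∃ k, HasSpectralFlow A k then hA.choose else 0

end SelfAdjoint

end

end SpecFlow

namespace SpecFlow

open Complex Set Filter Topology

noncomputable section

section Pencil

variable {H : Type*} [NormedAddCommGroup H] [InnerProductSpace ℂ H] [CompleteSpace H]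

/-- The bounded operator `(K - T) (-i - T)⁻¹`, for bounded `K`. -/
def pencil (T : H →ₗ.[ℂ] H) (K : H →L[ℂ] H) : H →L[ℂ] H :=
  1 + (K + I • 1) * resolvent T (-I)

/-- The inverse of `K - T`, if `pencil T K` is a unit. -/
def genResolvent (T : H →ₗ.[ℂ] H) (K : H →L[ℂ] H) : H →L[ℂ] H :=
  resolvent T (-I) * Ring.inverse (pencil T K)

variable {T : H →ₗ.[ℂ] H} (hT : IsSelfAdjoint T)
include hT

theorem resolvent_neg_I_apply (x : T.domain) : resolvent T (-I) ((-I) • (x : H) - T x) = x :=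
  (resolvent_spec (neg_I_mem_resolventSet hT)).1 x

theorem exists_resolvent_neg_I (y : H) :
    ∃ x : T.domain, (x : H) = resolvent T (-I) y ∧ (-I) • (x : H) - T x = y :=
  (resolvent_spec (neg_I_mem_resolventSet hT)).2 y

theorem pencil_apply (K : H →L[ℂ] H) (x : T.domain) :
    pencil T K ((-I) • (x : H) - T x) = K x - T x := by
  simp only [pencil, add_apply, mul_apply_eq_comp,
    one_apply_eq_self, resolvent_neg_I_apply hT, smul_apply]
  module

theorem genResolvent_left {K : H →L[ℂ] H} (hK : IsUnit (pencil T K)) (x : T.domain) :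
    genResolvent T K (K x - T x) = x := by
  rw [← pencil_apply hT, genResolvent, mul_apply_eq_comp, ← mul_apply_eq_comp (Ring.inverse _),
    Ring.inverse_mul_cancel _ hK, one_apply_eq_self, resolvent_neg_I_apply hT]

theorem genResolvent_right {K : H →L[ℂ] H} (hK : IsUnit (pencil T K)) (y : H) :
    ∃ x : T.domain, (x : H) = genResolvent T K y ∧ K x - T x = y := by
  obtain ⟨x, hx, hx'⟩ := exists_resolvent_neg_I hT (Ring.inverse (pencil T K) y)
  refine ⟨x, hx, ?_⟩
  rw [← pencil_apply hT, hx', ← mul_apply_eq_comp, Ring.mul_inverse_cancel _ hK,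
    one_apply_eq_self]

/-- `K - T` is invertible if it is bounded below and its adjoint is injective. -/
theorem isUnit_pencil {K : H →L[ℂ] H} {c : ℝ} (hc : 0 < c)
    (hb : ∀ x : T.domain, c * ‖(x : H)‖ ≤ ‖K x - T x‖)
    (hadj : ∀ x : T.domain, K.adjoint x = T x → (x : H) = 0) : IsUnit (pencil T K) := by
  set M : ℝ := ‖K + I • (1 : H →L[ℂ] H)‖ with hM
  have hM0 : 0 ≤ M := norm_nonneg _
  have hbelow : ∀ y, ‖y‖ ≤ (1 + M / c) * ‖pencil T K y‖ := by
    intro y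
    obtain ⟨x, -, rfl⟩ := exists_resolvent_neg_I hT y
    have h1 : (-I) • (x : H) - T x = pencil T K ((-I) • (x : H) - T x)
        - (K + I • (1 : H →L[ℂ] H)) x := by
      rw [pencil_apply hT]
      simp only [add_apply, one_apply_eq_self, smul_apply]
      module
    have h2 : ‖(x : H)‖ ≤ ‖pencil T K ((-I) • (x : H) - T x)‖ / c := by
      rw [pencil_apply hT, le_div_iff₀' hc]
      exact hb x
    calc ‖(-I) • (x : H) - T x‖
        ≤ ‖pencil T K ((-I) • (x : H) - T x)‖ + ‖(K + I • (1 : H →L[ℂ] H)) x‖ := by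
          conv_lhs => rw [h1]
          exact norm_sub_le _ _
      _ ≤ ‖pencil T K ((-I) • (x : H) - T x)‖ +
          M * (‖pencil T K ((-I) • (x : H) - T x)‖ / c) := by
          gcongr
          exact ((K + I • (1 : H →L[ℂ] H)).le_opNorm x).trans (by gcongr)
      _ = _ := by ring
  have hanti : AntilipschitzWith ⟨1 + M / c, by positivity⟩ (pencil T K) :=
    AddMonoidHomClass.antilipschitz_of_bound _ hbelow
  have hclosed : IsClosed (LinearMap.range (pencil T K).toLinearMap : Set H) := by
    have := hanti.isClosed_range (pencil T K).uniformContinuous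
    rwa [← ContinuousLinearMap.coe_coe, ← LinearMap.coe_range] at this
  have horth : (LinearMap.range (pencil T K).toLinearMap)ᗮ = ⊥ := by
    rw [Submodule.eq_bot_iff]
    intro u hu
    have hu' : ∀ x : T.domain, inner ℂ (K.adjoint u) (x : H) = inner ℂ u (T x) := fun x => by
      have := (Submodule.mem_orthogonal' _ _).mp hu _ ⟨(-I) • (x : H) - T x, rfl⟩
      change inner ℂ u (pencil T K _) = 0 at this
      rw [pencil_apply hT, inner_sub_right, sub_eq_zero] at this
      rw [ContinuousLinearMap.adjoint_inner_left, this]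
    have hmem : u ∈ T.adjoint.domain := LinearPMap.mem_adjoint_domain_of_exists u ⟨_, hu'⟩
    have happ : T.adjoint ⟨u, hmem⟩ = K.adjoint u :=
      LinearPMap.adjoint_apply_eq hT.dense_domain ⟨u, hmem⟩ hu'
    have hg : (u, K.adjoint u) ∈ T.adjoint.graph := by
      have := T.adjoint.mem_graph ⟨u, hmem⟩
      rwa [happ] at this
    rw [LinearPMap.isSelfAdjoint_def.mp hT] at hg
    obtain ⟨x, hx1, hx2⟩ := (LinearPMap.mem_graph_iff T).mp hg
    simp only at hx1 hx2
    rw [← hx1]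
    exact hadj x (by rw [hx1, hx2])
  have htop : LinearMap.range (pencil T K).toLinearMap = ⊤ := by
    have : CompleteSpace (LinearMap.range (pencil T K).toLinearMap) := hclosed.completeSpace_coe
    exact Submodule.orthogonal_eq_bot_iff.mp horth
  exact ContinuousLinearMap.isUnit_iff_bijective.mpr
    ⟨hanti.injective, LinearMap.range_eq_top.mp htop⟩

theorem im_inner_apply_self (x : T.domain) : (inner ℂ (x : H) (T x)).im = 0 := by
  have := inner_symm_of_isSelfAdjoint hT x x
  rw [← inner_conj_symm] at this
  exact Complex.conj_eq_iff_im.mp this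

theorem norm_conj_smul_sub (z : ℂ) (x : T.domain) :
    ‖(starRingEnd ℂ z) • (x : H) - T x‖ = ‖z • (x : H) - T x‖ := by
  have : ‖(starRingEnd ℂ z) • (x : H) - T x‖ ^ 2 = ‖z • (x : H) - T x‖ ^ 2 := by
    rw [@norm_sub_sq ℂ, @norm_sub_sq ℂ, inner_smul_left, inner_smul_left, norm_smul, norm_smul]
    simp [im_inner_apply_self hT x]
  exact (pow_left_inj₀ (norm_nonneg _) (norm_nonneg _) two_ne_zero).mp this

theorem abs_im_mul_norm_le (z : ℂ) (x : T.domain) :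
    |z.im| * ‖(x : H)‖ ≤ ‖z • (x : H) - T x‖ := by
  have h1 : (inner ℂ (x : H) (z • (x : H) - T x)).im = z.im * ‖(x : H)‖ ^ 2 := by
    rw [inner_sub_right, inner_smul_right, inner_self_eq_norm_sq_to_K, Complex.sub_im,
      im_inner_apply_self hT x, sub_zero, ← RCLike.ofReal_pow]
    exact Complex.im_mul_ofReal _ _
  have h2 : |z.im| * ‖(x : H)‖ ^ 2 ≤ ‖(x : H)‖ * ‖z • (x : H) - T x‖ := by
    rw [← abs_of_nonneg (sq_nonneg ‖(x : H)‖), ← abs_mul, ← h1]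
    exact (Complex.abs_im_le_norm _).trans (norm_inner_le_norm _ _)
  rcases (norm_nonneg (x : H)).eq_or_lt with h | h
  · rw [← h, mul_zero]; positivity
  · refine le_of_mul_le_mul_left ?_ h
    linarith

theorem mem_resolventSet_of_isUnit {z : ℂ} (hz : IsUnit (pencil T (z • 1))) :
    z ∈ resolventSet T :=
  ⟨genResolvent T (z • 1), genResolvent_left hT hz, genResolvent_right hT hz⟩

theorem resolvent_eq_genResolvent {z : ℂ} (hz : IsUnit (pencil T (z • 1))) :
    resolvent T z = genResolvent T (z • 1) :=
  (resolvent_spec (mem_resolventSet_of_isUnit hT hz)).unique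
    ⟨genResolvent_left hT hz, genResolvent_right hT hz⟩

theorem isUnit_pencil_of_bound {z : ℂ} {c : ℝ} (hc : 0 < c)
    (hb : ∀ x : T.domain, c * ‖(x : H)‖ ≤ ‖z • (x : H) - T x‖) : IsUnit (pencil T (z • 1)) := by
  refine isUnit_pencil hT hc hb fun x hx => ?_
  have h1 : (starRingEnd ℂ z) • (x : H) = T x := by
    rwa [← ContinuousLinearMap.star_eq_adjoint, star_smul, star_one] at hx
  have h2 := hb x
  rw [← norm_conj_smul_sub hT, h1, sub_self, norm_zero] at h2
  exact norm_le_zero_iff.mp (nonpos_of_mul_nonpos_right h2 hc)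

theorem mem_resolventSet_iff_isUnit {z : ℂ} : z ∈ resolventSet T ↔ IsUnit (pencil T (z • 1)) := by
  refine ⟨fun ⟨R, hR, _⟩ => ?_, mem_resolventSet_of_isUnit hT⟩
  refine isUnit_pencil_of_bound hT (c := (‖R‖ + 1)⁻¹) (by positivity) fun x => ?_
  rw [inv_mul_le_iff₀ (by positivity)]
  have h1 : R (z • (x : H) - T x) = x := hR x
  calc ‖(x : H)‖ = ‖R (z • (x : H) - T x)‖ := by rw [h1]
    _ ≤ ‖R‖ * ‖z • (x : H) - T x‖ := R.le_opNorm _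
    _ ≤ _ := by gcongr; linarith

theorem mem_resolventSet_of_im_ne_zero {z : ℂ} (hz : z.im ≠ 0) : z ∈ resolventSet T :=
  mem_resolventSet_of_isUnit hT
    (isUnit_pencil_of_bound hT (abs_pos.mpr hz) (abs_im_mul_norm_le hT z))

end Pencil

section Reducing

variable {H : Type*} [NormedAddCommGroup H] [InnerProductSpace ℂ H]

/-- `E` is contained in the domain of `T` and mapped to itself. -/
def IsInvariant (T : H →ₗ.[ℂ] H) (E : Submodule ℂ H) : Prop :=
  ∀ v ∈ E, ∃ x : T.domain, (x : H) = v ∧ T x ∈ E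

theorem norm_le_norm_add_of_orthogonal {E : Submodule ℂ H} {u v : H} (hu : u ∈ E) (hv : v ∈ Eᗮ) :
    ‖u‖ ≤ ‖u + v‖ ∧ ‖v‖ ≤ ‖u + v‖ := by
  have := norm_add_sq_eq_norm_sq_add_norm_sq_of_inner_eq_zero (𝕜 := ℂ) u v
    (Submodule.inner_right_of_mem_orthogonal hu hv)
  constructor <;> refine abs_le_of_sq_le_sq' ?_ (norm_nonneg _) |>.2 <;>
    nlinarith [sq_nonneg ‖u‖, sq_nonneg ‖v‖]

variable [CompleteSpace H] {T : H →ₗ.[ℂ] H} (hT : IsSelfAdjoint T) {E : Submodule ℂ H}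
include hT

theorem IsInvariant.map_orthogonal (hE : IsInvariant T E) (x : T.domain) (hx : (x : H) ∈ Eᗮ) :
    T x ∈ Eᗮ := by
  rw [Submodule.mem_orthogonal]
  intro v hv
  obtain ⟨w, rfl, hw⟩ := hE v hv
  rw [← inner_symm_of_isSelfAdjoint hT]
  exact Submodule.inner_right_of_mem_orthogonal hw hx

variable [E.HasOrthogonalProjection]

theorem IsInvariant.exists_decomp (hE : IsInvariant T E) (x : T.domain) :
    ∃ n y : T.domain, x = n + y ∧ (n : H) = E.starProjection x ∧ (n : H) ∈ E ∧ T n ∈ E ∧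
      (y : H) ∈ Eᗮ ∧ T y ∈ Eᗮ := by
  obtain ⟨n, hn, hn'⟩ := hE _ (E.starProjection_apply_mem x)
  have hy : ((x - n : T.domain) : H) ∈ Eᗮ := by
    rw [AddSubgroupClass.coe_sub, hn]
    exact Submodule.sub_starProjection_mem_orthogonal _
  exact ⟨n, x - n, by abel, hn, by rw [hn]; exact E.starProjection_apply_mem _, hn', hy,
    hE.map_orthogonal hT _ hy⟩

/-- Lower bounds for `z + w - T` on `E` and for `z - T` on `Eᗮ` give one for `z + wP - T`,
where `P` is the orthogonal projection onto `E`. -/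
theorem IsInvariant.block_bound (hE : IsInvariant T E) {z w : ℂ} {c : ℝ}
    (h1 : ∀ x : T.domain, (x : H) ∈ E → c * ‖(x : H)‖ ≤ ‖(z + w) • (x : H) - T x‖)
    (h2 : ∀ x : T.domain, (x : H) ∈ Eᗮ → c * ‖(x : H)‖ ≤ ‖z • (x : H) - T x‖) (hc : 0 < c)
    (x : T.domain) :
    c / 2 * ‖(x : H)‖ ≤ ‖(z • 1 + w • E.starProjection : H →L[ℂ] H) x - T x‖ := by
  obtain ⟨n, y, rfl, hn, hnE, hTn, hyE, hTy⟩ := hE.exists_decomp hT x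
  have hK : (z • 1 + w • E.starProjection : H →L[ℂ] H) ((n + y : T.domain) : H) - T (n + y) =
      ((z + w) • (n : H) - T n) + (z • (y : H) - T y) := by
    rw [LinearPMap.map_add, add_apply, smul_apply,
      smul_apply, ← hn, one_apply_eq_self, Submodule.coe_add]
    module
  obtain ⟨h3, h4⟩ := norm_le_norm_add_of_orthogonal
    (E.sub_mem (E.smul_mem (z + w) hnE) hTn) (Eᗮ.sub_mem (Eᗮ.smul_mem z hyE) hTy)
  rw [hK, Submodule.coe_add]
  have h5 := h1 n hnE
  have h6 := h2 y hyE
  nlinarith [norm_add_le (n : H) (y : H)]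

theorem IsInvariant.isUnit_pencil (hE : IsInvariant T E) {z w : ℂ} {c : ℝ}
    (h1 : ∀ x : T.domain, (x : H) ∈ E → c * ‖(x : H)‖ ≤ ‖(z + w) • (x : H) - T x‖)
    (h2 : ∀ x : T.domain, (x : H) ∈ Eᗮ → c * ‖(x : H)‖ ≤ ‖z • (x : H) - T x‖) (hc : 0 < c) :
    IsUnit (pencil T (z • 1 + w • E.starProjection)) := by
  refine SpecFlow.isUnit_pencil hT (half_pos hc) (hE.block_bound hT h1 h2 hc) fun x hx => ?_
  have h3 := hE.block_bound hT (z := starRingEnd ℂ z) (w := starRingEnd ℂ w) (c := c)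
    (fun x hx => by rw [← map_add, norm_conj_smul_sub hT]; exact h1 x hx)
    (fun x hx => by rw [norm_conj_smul_sub hT]; exact h2 x hx) hc x
  have h4 : (z • 1 + w • E.starProjection : H →L[ℂ] H).adjoint =
      (starRingEnd ℂ z) • 1 + (starRingEnd ℂ w) • E.starProjection := by
    have := (isSelfAdjoint_starProjection E).star_eq
    simp only [← ContinuousLinearMap.star_eq_adjoint, star_add, star_smul, star_one, this]
    rfl
  rw [← h4, hx, sub_self, norm_zero] at h3
  exact norm_le_zero_iff.mp (nonpos_of_mul_nonpos_right h3 (half_pos hc))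

end Reducing

section Eigenspaces

variable {H : Type*} [NormedAddCommGroup H] [InnerProductSpace ℂ H]

theorem mem_eigenspace {T : H →ₗ.[ℂ] H} {μ : ℝ} {v : H} :
    v ∈ eigenspace T μ ↔ ∃ x : T.domain, (x : H) = v ∧ T x = (μ : ℂ) • (x : H) := by
  constructor
  · rintro ⟨x, hx, rfl⟩
    refine ⟨x, rfl, ?_⟩
    have : (μ : ℂ) • (x : H) - T x = 0 := hx
    rw [sub_eq_zero.mp this]
  · rintro ⟨x, rfl, hx⟩
    refine ⟨x, ?_, rfl⟩
    change (μ : ℂ) • (x : H) - T x = 0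
    rw [hx, sub_self]

theorem isInvariant_eigenspace (T : H →ₗ.[ℂ] H) (μ : ℝ) : IsInvariant T (eigenspace T μ) := by
  intro v hv
  obtain ⟨x, rfl, hx⟩ := mem_eigenspace.mp hv
  exact ⟨x, rfl, hx ▸ Submodule.smul_mem _ _ hv⟩

theorem IsInvariant.iSup {T : H →ₗ.[ℂ] H} {ι : Sort*} {E : ι → Submodule ℂ H}
    (hE : ∀ i, IsInvariant T (E i)) : IsInvariant T (⨆ i, E i) := by
  intro v hv
  induction hv using Submodule.iSup_induction' with
  | mem i v hv =>
    obtain ⟨x, hx, hx'⟩ := hE i v hv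
    exact ⟨x, hx, Submodule.mem_iSup_of_mem i hx'⟩
  | zero => exact ⟨0, rfl, by simp⟩
  | add u v _ _ hu hv =>
    obtain ⟨x, rfl, hx⟩ := hu
    obtain ⟨y, rfl, hy⟩ := hv
    exact ⟨x + y, rfl, by rw [LinearPMap.map_add]; exact Submodule.add_mem _ hx hy⟩

theorem isInvariant_eigenspaceSum (T : H →ₗ.[ℂ] H) (c d : ℝ) :
    IsInvariant T (eigenspaceSum T c d) :=
  IsInvariant.iSup fun μ => IsInvariant.iSup fun _ => isInvariant_eigenspace T μ

theorem eigenspace_le_eigenspaceSum (T : H →ₗ.[ℂ] H) {c d μ : ℝ} (hμ : μ ∈ Icc c d) :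
    eigenspace T μ ≤ eigenspaceSum T c d :=
  le_iSup₂_of_le μ hμ le_rfl

theorem eigenspace_eq_bot_of_mem_resolventSet {T : H →ₗ.[ℂ] H} {μ : ℝ}
    (hμ : (μ : ℂ) ∈ resolventSet T) : eigenspace T μ = ⊥ := by
  rw [Submodule.eq_bot_iff]
  intro v hv
  obtain ⟨x, rfl, hx⟩ := mem_eigenspace.mp hv
  obtain ⟨R, hR, -⟩ := hμ
  have h1 : R ((μ : ℂ) • (x : H) - T x) = x := hR x
  rw [← h1, hx, sub_self, map_zero]

theorem finiteDimensional_eigenspace {T : H →ₗ.[ℂ] H} {μ : ℝ}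
    (hF : IsFredholm (scalarSub (μ : ℂ) T)) : FiniteDimensional ℂ (eigenspace T μ) := by
  have := hF.2.1
  exact Module.Finite.map (LinearMap.ker (scalarSub (μ : ℂ) T).toFun)
    (scalarSub (μ : ℂ) T).domain.subtype

variable [CompleteSpace H] {T : H →ₗ.[ℂ] H} (hT : IsSelfAdjoint T)
include hT

theorem eigenspace_isOrtho {μ ν : ℝ} (h : μ ≠ ν) : eigenspace T μ ⟂ eigenspace T ν := by
  rw [Submodule.isOrtho_iff_inner_eq]
  intro u hu v hv
  obtain ⟨x, rfl, hx⟩ := mem_eigenspace.mp hu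
  obtain ⟨y, rfl, hy⟩ := mem_eigenspace.mp hv
  have h1 := inner_symm_of_isSelfAdjoint hT x y
  rw [hx, hy, inner_smul_left, inner_smul_right, Complex.conj_ofReal, mul_eq_mul_right_iff] at h1
  exact h1.resolve_left fun h2 => h (by exact_mod_cast h2)

/-- If `μ - T` is Fredholm, it is bounded below on the orthogonal complement of its kernel. -/
theorem IsFredholm.exists_lower_bound {μ : ℝ} (hF : IsFredholm (scalarSub (μ : ℂ) T)) :
    ∃ c > 0, ∀ x : T.domain, (x : H) ∈ (eigenspace T μ)ᗮ →
      c * ‖(x : H)‖ ≤ ‖(μ : ℂ) • (x : H) - T x‖ := by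
  set S := scalarSub (μ : ℂ) T with hS
  obtain ⟨C, hC⟩ := Submodule.exists_isCompl (LinearMap.range S.toFun)
  have := hF.2.2
  have hfd : FiniteDimensional ℂ C :=
    Module.Finite.equiv (Submodule.quotientEquivOfIsCompl _ C hC)
  have hc : IsClosed (T.graph : Set (H × H)) := hT.isClosed
  have : CompleteSpace T.graph := hc.completeSpace_coe
  have : CompleteSpace C := FiniteDimensional.complete ℂ C
  let f : T.graph →L[ℂ] H :=
    ((μ : ℂ) • ContinuousLinearMap.fst ℂ H H - ContinuousLinearMap.snd ℂ H H).comp T.graph.subtypeL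
  have hf : ∀ x : T.domain, f ⟨_, T.mem_graph x⟩ = S x := fun _ => rfl
  let g : T.graph × C →L[ℂ] H := f.coprod C.subtypeL
  have hg : ∀ p : T.graph × C, g p = f p.1 + (p.2 : H) := fun _ => rfl
  have hsurj : Function.Surjective g := by
    intro y
    have hy : y ∈ LinearMap.range S.toFun ⊔ C := by rw [hC.sup_eq_top]; trivial
    obtain ⟨u, ⟨x, rfl⟩, v, hv, rfl⟩ := Submodule.mem_sup.mp hy
    exact ⟨(⟨_, T.mem_graph x⟩, ⟨v, hv⟩), rfl⟩
  obtain ⟨K, hK, hbound⟩ := g.exists_preimage_norm_le hsurj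
  refine ⟨K⁻¹, inv_pos.mpr hK, fun x hx => ?_⟩
  rw [inv_mul_le_iff₀ hK]
  obtain ⟨⟨⟨q, hq⟩, v⟩, hp1, hp2⟩ := hbound (S x)
  obtain ⟨x', rfl⟩ := (LinearPMap.mem_graph_iff' _).mp hq
  rw [hg, hf] at hp1
  have hv : (v : H) ∈ LinearMap.range S.toFun := by
    exact ⟨x - x', (S.toFun.map_sub x x').trans (sub_eq_of_eq_add' hp1.symm)⟩
  have hv0 : (v : H) = 0 := Submodule.disjoint_def.mp hC.disjoint _ hv v.2
  rw [hv0, add_zero] at hp1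
  have hker : (x' - x : H) ∈ eigenspace T μ := by
    exact ⟨x' - x, (S.toFun.map_sub x' x).trans (sub_eq_zero.mpr hp1), rfl⟩
  have h1 := (norm_le_norm_add_of_orthogonal hker hx).2
  rw [sub_add_cancel] at h1
  refine h1.trans (le_trans ?_ hp2)
  exact (le_max_left _ _).trans (le_max_left _ _)

theorem isClosed_scalarSub (z : ℂ) : (scalarSub z T).IsClosed := by
  set S := scalarSub z T with hS
  have hc : IsClosed (T.graph : Set (H × H)) := hT.isClosed
  have : (S.graph : Set (H × H)) = (fun p : H × H => (p.1, z • p.1 - p.2)) ⁻¹' T.graph := by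
    ext ⟨u, v⟩
    simp only [SetLike.mem_coe, mem_preimage, LinearPMap.mem_graph_iff', Prod.mk.injEq]
    constructor
    · rintro ⟨x, rfl, rfl⟩
      exact ⟨x, rfl, (sub_sub_cancel _ _).symm⟩
    · rintro ⟨x, rfl, hx⟩
      exact ⟨x, rfl, (congrArg (z • (x : H) - ·) hx).trans (sub_sub_cancel _ _)⟩
  change IsClosed (S.graph : Set (H × H))
  rw [this]
  exact hc.preimage (by fun_prop)

theorem isFredholm_of_isUnit {z : ℂ} {F : H →L[ℂ] H} (hF : IsUnit (pencil T (z • 1 + F)))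
    (hfin : FiniteDimensional ℂ (LinearMap.range F.toLinearMap)) :
    IsFredholm (scalarSub z T) := by
  set S := scalarSub z T with hS
  have hSx : ∀ x : T.domain, S x = z • (x : H) - T x := fun _ => rfl
  set G := genResolvent T (z • 1 + F) with hG
  refine ⟨isClosed_scalarSub hT z, ?_, ?_⟩
  · have hle : (LinearMap.ker S.toFun).map S.domain.subtype ≤
        (LinearMap.range F.toLinearMap).map G.toLinearMap := by
      rintro _ ⟨x, hx, rfl⟩
      have hx' : z • (x : H) - T x = 0 := hx
      refine ⟨F x, ⟨x, rfl⟩, ?_⟩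
      have h1 := genResolvent_left hT hF x
      have h2 : (z • 1 + F : H →L[ℂ] H) x - T x = F x := by
        simp only [add_apply, smul_apply, one_apply_eq_self]
        rw [← sub_eq_zero, ← hx']
        abel
      rw [h2] at h1
      exact h1
    have h1 : FiniteDimensional ℂ ((LinearMap.range F.toLinearMap).map G.toLinearMap) :=
      Module.Finite.map _ _
    have h2 := Submodule.finiteDimensional_of_le hle
    exact Module.Finite.equiv
      (Submodule.equivMapOfInjective _ S.domain.injective_subtype (LinearMap.ker S.toFun)).symm
  · refine Module.Finite.of_surjective
      ((LinearMap.range S.toFun).mkQ ∘ₗ (LinearMap.range F.toLinearMap).subtype) fun q => ?_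
    obtain ⟨y, rfl⟩ := Submodule.mkQ_surjective _ q
    obtain ⟨x, hx, hx'⟩ := genResolvent_right hT hF y
    refine ⟨⟨F x, x, rfl⟩, ?_⟩
    have hy : S x = y - F x := by
      rw [hSx, ← hx']
      simp only [add_apply, smul_apply, one_apply_eq_self]
      abel
    exact ((Submodule.Quotient.eq (LinearMap.range S.toFun)).mpr ⟨x, hy⟩).symm

theorem isFredholm_of_mem_resolventSet {z : ℂ} (hz : z ∈ resolventSet T) :
    IsFredholm (scalarSub z T) := by
  refine isFredholm_of_isUnit hT (F := 0) ?_ ?_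
  · rw [add_zero]
    exact (mem_resolventSet_iff_isUnit hT).mp hz
  · rw [ContinuousLinearMap.toLinearMap_zero, LinearMap.range_zero]
    infer_instance

theorem IsFredholm.scalarSub_zero (hF : IsFredholm T) : IsFredholm (scalarSub 0 T) := by
  have h : (scalarSub 0 T).toFun = -T.toFun := by
    simp only [scalarSub, zero_smul, zero_sub]
    rfl
  refine ⟨isClosed_scalarSub hT 0, ?_, ?_⟩
  · rw [h]
    exact (LinearMap.ker_neg T.toFun).symm ▸ hF.2.1
  · rw [h]
    exact (LinearMap.range_neg T.toFun).symm ▸ hF.2.2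

theorem exists_isUnit_of_isFredholm {μ : ℝ} (hF : IsFredholm (scalarSub (μ : ℂ) T)) :
    ∃ F : H →L[ℂ] H, FiniteDimensional ℂ (LinearMap.range F.toLinearMap) ∧
      IsUnit (pencil T ((μ : ℂ) • 1 + F)) := by
  have := finiteDimensional_eigenspace hF
  obtain ⟨c, hc, hb⟩ := hF.exists_lower_bound hT
  refine ⟨I • (eigenspace T μ).starProjection, ?_, ?_⟩
  · refine Submodule.finiteDimensional_of_le (S₂ := eigenspace T μ) ?_
    rintro _ ⟨x, rfl⟩
    exact Submodule.smul_mem _ _ (Submodule.starProjection_apply_mem _ _)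
  · refine (isInvariant_eigenspace T μ).isUnit_pencil hT (c := min c 1) ?_ ?_ (by positivity)
    · intro x _
      refine le_trans ?_ (abs_im_mul_norm_le hT _ x)
      simpa using mul_le_of_le_one_left (norm_nonneg (x : H)) (min_le_right c 1)
    · intro x hx
      exact le_trans (by gcongr; exact min_le_left _ _) (hb x hx)

theorem mem_resolventSet_of_eigenspace_eq_bot {μ : ℝ} (hF : IsFredholm (scalarSub (μ : ℂ) T))
    (hμ : eigenspace T μ = ⊥) : (μ : ℂ) ∈ resolventSet T := by
  obtain ⟨c, hc, hb⟩ := hF.exists_lower_bound hT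
  exact mem_resolventSet_of_isUnit hT (isUnit_pencil_of_bound hT hc fun x => hb x (by simp [hμ]))

theorem IsFredholm.eventually_mem_resolventSet {μ : ℝ} (hF : IsFredholm (scalarSub (μ : ℂ) T)) :
    ∃ ε > 0, ∀ t : ℝ, t ≠ μ → |t - μ| < ε → (t : ℂ) ∈ resolventSet T := by
  have := finiteDimensional_eigenspace hF
  obtain ⟨c, hc, hb⟩ := hF.exists_lower_bound hT
  refine ⟨c, hc, fun t ht htc => ?_⟩
  have hpos : 0 < min |t - μ| (c - |t - μ|) :=
    lt_min (abs_pos.mpr (sub_ne_zero.mpr ht)) (sub_pos.mpr htc)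
  have hn : ‖((t : ℂ) - μ)‖ = |t - μ| := by
    rw [← Complex.ofReal_sub, Complex.norm_real, Real.norm_eq_abs]
  have h := (isInvariant_eigenspace T μ).isUnit_pencil hT (z := t) (w := 0) ?_ ?_ hpos
  · rw [zero_smul, add_zero] at h
    exact mem_resolventSet_of_isUnit hT h
  · intro x hx
    obtain ⟨y, hy, hy'⟩ := mem_eigenspace.mp hx
    obtain rfl := Subtype.ext hy
    rw [hy', add_zero, ← sub_smul, norm_smul, hn]
    gcongr
    exact min_le_left _ _
  · intro x hx
    have h1 := hb x hx
    have h2 : (μ : ℂ) • (x : H) - T x = ((t : ℂ) • (x : H) - T x) - ((t : ℂ) - μ) • (x : H) := by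
      module
    have h3 := norm_sub_le ((t : ℂ) • (x : H) - T x) (((t : ℂ) - μ) • (x : H))
    rw [← h2, norm_smul, hn] at h3
    have h4 : min |t - μ| (c - |t - μ|) * ‖(x : H)‖ ≤ (c - |t - μ|) * ‖(x : H)‖ := by
      gcongr
      exact min_le_right _ _
    linarith

end Eigenspaces

section SpectralProjection

variable {H : Type*} [NormedAddCommGroup H] [InnerProductSpace ℂ H]

/-- The endpoints of `[c, d]` are in the resolvent set, and `[c, d]` does not meet the essential
spectrum. -/
structure IsAdmissible (T : H →ₗ.[ℂ] H) (c d : ℝ) : Prop where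
  left : (c : ℂ) ∈ resolventSet T
  right : (d : ℂ) ∈ resolventSet T
  disj : ∀ μ ∈ Icc c d, (μ : ℂ) ∉ essSpectrum T

theorem notMem_essSpectrum {T : H →ₗ.[ℂ] H} {z : ℂ} :
    z ∉ essSpectrum T ↔ IsFredholm (scalarSub z T) :=
  not_not

theorem mem_circle_cases {c d : ℝ} {z : ℂ}
    (hz : z ∈ Metric.closedBall (((c + d) / 2 : ℝ) : ℂ) ((d - c) / 2)) :
    |z.im| ≤ (d - c) / 2 ∧ z.re ∈ Icc c d := by
  rw [mem_closedBall_iff_norm] at hz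
  have h1 := (Complex.abs_im_le_norm _).trans hz
  have h2 := abs_le.mp ((Complex.abs_re_le_norm _).trans hz)
  simp only [Complex.sub_im, Complex.ofReal_im, sub_zero, Complex.sub_re, Complex.ofReal_re]
    at h1 h2
  exact ⟨h1, by linarith, by linarith⟩

theorem eq_endpoint_of_mem_sphere {c d : ℝ} {z : ℂ}
    (hz : z ∈ Metric.sphere (((c + d) / 2 : ℝ) : ℂ) ((d - c) / 2)) (him : z.im = 0) :
    z = c ∨ z = d := by
  have hz' : z = (z.re : ℂ) := Complex.ext rfl (by simp [him])
  rw [mem_sphere_iff_norm, hz', ← Complex.ofReal_sub, Complex.norm_real, Real.norm_eq_abs] at hz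
  rcases abs_cases (z.re - (c + d) / 2) with ⟨h, -⟩ | ⟨h, -⟩
  · right; rw [hz']; congr 1; linarith
  · left; rw [hz']; congr 1; linarith

theorem circleIntegral_apply {f : ℂ → H →L[ℂ] H} {c : ℂ} {R : ℝ} (hf : CircleIntegrable f c R)
    (v : H) : (∮ z in C(c, R), f z) v = ∮ z in C(c, R), f z v := by
  unfold circleIntegral
  rw [ContinuousLinearMap.intervalIntegral_apply hf.out]
  rfl

variable [CompleteSpace H] {T : H →ₗ.[ℂ] H}

theorem differentiableAt_genResolvent {F : H →L[ℂ] H} {z : ℂ}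
    (hz : IsUnit (pencil T (z • 1 + F))) :
    DifferentiableAt ℂ (fun z : ℂ => genResolvent T (z • 1 + F)) z := by
  unfold genResolvent
  refine DifferentiableAt.const_mul ?_ _
  refine (differentiableAt_inverse hz).fun_comp' z ?_
  unfold pencil
  fun_prop

variable (hT : IsSelfAdjoint T)
include hT

theorem finiteDimensional_eigenspaceSum {c d : ℝ} (hF : ∀ μ ∈ Icc c d, (μ : ℂ) ∉ essSpectrum T) :
    FiniteDimensional ℂ (eigenspaceSum T c d) := by
  set S : Set ℝ := {μ ∈ Icc c d | (μ : ℂ) ∉ resolventSet T} with hS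
  have hfin : S.Finite := by
    by_contra hinf
    obtain ⟨μ, hμ, hacc⟩ := Set.Infinite.exists_accPt_of_subset_isCompact hinf isCompact_Icc
      (fun _ h => h.1)
    obtain ⟨ε, hε, h⟩ := (notMem_essSpectrum.mp (hF μ hμ)).eventually_mem_resolventSet hT
    obtain ⟨t, ht⟩ := (accPt_iff_nhds.mp hacc) _ (Metric.ball_mem_nhds μ hε)
    exact ht.1.2.2 (h t ht.2 (by simpa [Real.dist_eq] using ht.1.1))
  have : Finite S := hfin
  have hle : eigenspaceSum T c d ≤ ⨆ μ : S, eigenspace T μ := by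
    refine iSup₂_le fun μ hμ => ?_
    by_cases h : (μ : ℂ) ∈ resolventSet T
    · rw [eigenspace_eq_bot_of_mem_resolventSet h]
      exact bot_le
    · exact le_iSup (fun μ : S => eigenspace T μ) ⟨μ, hμ, h⟩
  have hfd : ∀ μ : S, FiniteDimensional ℂ (eigenspace T μ) := fun μ =>
    finiteDimensional_eigenspace (notMem_essSpectrum.mp (hF μ μ.2.1))
  exact Submodule.finiteDimensional_of_le hle

theorem continuousOn_resolvent : ContinuousOn (fun z => resolvent T z) (resolventSet T) := by
  have h : ContinuousOn (fun z : ℂ => genResolvent T (z • 1)) (resolventSet T) := by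
    intro z hz
    have := differentiableAt_genResolvent (T := T) (F := 0) (z := z)
      (by rw [add_zero]; exact (mem_resolventSet_iff_isUnit hT).mp hz)
    simp only [add_zero] at this
    exact this.continuousAt.continuousWithinAt
  exact h.congr fun z hz => resolvent_eq_genResolvent hT ((mem_resolventSet_iff_isUnit hT).mp hz)

theorem sphere_subset_resolventSet {c d : ℝ} (hc : (c : ℂ) ∈ resolventSet T)
    (hd : (d : ℂ) ∈ resolventSet T) :
    Metric.sphere (((c + d) / 2 : ℝ) : ℂ) ((d - c) / 2) ⊆ resolventSet T := by
  intro z hz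
  by_cases him : z.im = 0
  · rcases eq_endpoint_of_mem_sphere hz him with rfl | rfl <;> assumption
  · exact mem_resolventSet_of_im_ne_zero hT him

theorem circleIntegrable_resolvent {c d : ℝ} (hcd : c ≤ d) (hc : (c : ℂ) ∈ resolventSet T)
    (hd : (d : ℂ) ∈ resolventSet T) :
    CircleIntegrable (fun z => resolvent T z) (((c + d) / 2 : ℝ) : ℂ) ((d - c) / 2) :=
  ((continuousOn_resolvent hT).mono (sphere_subset_resolventSet hT hc hd)).circleIntegrable
    (by linarith)

theorem spectralProj_apply {c d : ℝ} (hcd : c ≤ d) (hc : (c : ℂ) ∈ resolventSet T)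
    (hd : (d : ℂ) ∈ resolventSet T) (v : H) :
    spectralProj T c d v = (2 * Real.pi * I : ℂ)⁻¹ •
      circleIntegral (fun z => resolvent T z v) (((c + d) / 2 : ℝ) : ℂ) ((d - c) / 2) := by
  rw [spectralProj, smul_apply, circleIntegral_apply (circleIntegrable_resolvent hT hcd hc hd)]

theorem spectralProj_apply_of_mem_eigenspace {c d μ : ℝ} (hc : (c : ℂ) ∈ resolventSet T)
    (hd : (d : ℂ) ∈ resolventSet T) (hμ : μ ∈ Icc c d) {v : H} (hv : v ∈ eigenspace T μ) :
    spectralProj T c d v = v := by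
  by_cases hρ : (μ : ℂ) ∈ resolventSet T
  · rw [eigenspace_eq_bot_of_mem_resolventSet hρ, Submodule.mem_bot] at hv
    rw [hv, map_zero]
  have hcμ : c < μ := hμ.1.lt_of_ne fun h => hρ (h ▸ hc)
  have hμd : μ < d := hμ.2.lt_of_ne fun h => hρ (h ▸ hd)
  have hcd : c < d := hcμ.trans hμd
  have h1 : circleIntegral (fun z => resolvent T z v) (((c + d) / 2 : ℝ) : ℂ) ((d - c) / 2) =
      circleIntegral (fun z => (z - μ)⁻¹ • v) (((c + d) / 2 : ℝ) : ℂ) ((d - c) / 2) := by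
    refine circleIntegral.integral_congr (by linarith) fun z hz => ?_
    have hz := sphere_subset_resolventSet hT hc hd hz
    have hne : z - μ ≠ 0 := sub_ne_zero.mpr fun h => hρ (h ▸ hz)
    obtain ⟨x, rfl, hx⟩ := mem_eigenspace.mp hv
    have h2 : resolvent T z (z • (x : H) - T x) = x := (resolvent_spec hz).1 x
    rw [hx, ← sub_smul, map_smul] at h2
    change resolvent T z (x : H) = (z - μ)⁻¹ • (x : H)
    rw [eq_inv_smul_iff₀ hne, h2]
  rw [spectralProj_apply hT hcd.le hc hd, h1, circleIntegral.integral_smul_const,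
    circleIntegral.integral_sub_inv_of_mem_ball, inv_smul_smul₀ Complex.two_pi_I_ne_zero]
  rw [mem_ball_iff_norm, ← Complex.ofReal_sub, Complex.norm_real, Real.norm_eq_abs, abs_lt]
  constructor <;> linarith

theorem isUnit_pencil_of_mem_closedBall {c d : ℝ} (hcd : c < d)
    (hF : ∀ μ ∈ Icc c d, (μ : ℂ) ∉ essSpectrum T)
    [(eigenspaceSum T c d).HasOrthogonalProjection] {z : ℂ}
    (hz : z ∈ Metric.closedBall (((c + d) / 2 : ℝ) : ℂ) ((d - c) / 2)) :
    IsUnit (pencil T (z • 1 + (I * (d - c : ℝ)) • (eigenspaceSum T c d).starProjection)) := by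
  obtain ⟨him, hre⟩ := mem_circle_cases hz
  have h2 : ∃ b > 0, ∀ x : T.domain, (x : H) ∈ (eigenspaceSum T c d)ᗮ →
      b * ‖(x : H)‖ ≤ ‖z • (x : H) - T x‖ := by
    by_cases h0 : z.im = 0
    · obtain ⟨b, hb, h⟩ := (notMem_essSpectrum.mp (hF _ hre)).exists_lower_bound hT
      refine ⟨b, hb, fun x hx => ?_⟩
      have hz' : z = (z.re : ℂ) := Complex.ext rfl (by simp [h0])
      rw [hz']
      exact h x (Submodule.orthogonal_le (eigenspace_le_eigenspaceSum T hre) hx)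
    · exact ⟨|z.im|, abs_pos.mpr h0, fun x _ => abs_im_mul_norm_le hT z x⟩
  obtain ⟨b, hb, h2⟩ := h2
  have hpos : 0 < min b ((d - c) / 2) := lt_min hb (by linarith)
  refine (isInvariant_eigenspaceSum T c d).isUnit_pencil hT ?_ ?_ hpos
  · intro x _
    refine le_trans ?_ (abs_im_mul_norm_le hT _ x)
    gcongr
    refine (min_le_right _ _).trans (le_trans ?_ (le_abs_self _))
    have := (abs_le.mp him).1
    simp only [Complex.add_im, Complex.mul_im, Complex.I_re, Complex.I_im, Complex.ofReal_re,
      Complex.ofReal_im]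
    linarith
  · intro x hx
    exact le_trans (by gcongr; exact min_le_left _ _) (h2 x hx)

theorem spectralProj_apply_of_mem_orthogonal {c d : ℝ} (hcd : c < d) (hadm : IsAdmissible T c d)
    [(eigenspaceSum T c d).HasOrthogonalProjection] {v : H} (hv : v ∈ (eigenspaceSum T c d)ᗮ) :
    spectralProj T c d v = 0 := by
  have hE := isInvariant_eigenspaceSum T c d
  set F : H →L[ℂ] H := (I * (d - c : ℝ)) • (eigenspaceSum T c d).starProjection with hF
  have hunit := fun {z : ℂ} hz => isUnit_pencil_of_mem_closedBall hT hcd hadm.disj (z := z) hz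
  have h1 : circleIntegral (fun z => resolvent T z v) (((c + d) / 2 : ℝ) : ℂ) ((d - c) / 2) =
      circleIntegral (fun z => genResolvent T (z • 1 + F) v)
        (((c + d) / 2 : ℝ) : ℂ) ((d - c) / 2) := by
    refine circleIntegral.integral_congr (by linarith) fun z hz => ?_
    have hρ := sphere_subset_resolventSet hT hadm.left hadm.right hz
    obtain ⟨x, hx, hxv⟩ : ∃ x : T.domain, (x : H) = resolvent T z v ∧ z • (x : H) - T x = v :=
      (resolvent_spec hρ).2 v
    change resolvent T z v = genResolvent T (z • 1 + F) v
    obtain ⟨n, y, rfl, hn, hnE, hTn, hyE, hTy⟩ := hE.exists_decomp hT x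
    have hsum : z • ((n + y : T.domain) : H) - T (n + y) =
        (z • (n : H) - T n) + (z • (y : H) - T y) := by
      rw [LinearPMap.map_add, Submodule.coe_add]
      module
    have hn1 : z • (n : H) - T n ∈ eigenspaceSum T c d :=
      Submodule.sub_mem _ (Submodule.smul_mem _ z hnE) hTn
    have hn2 : z • (n : H) - T n ∈ (eigenspaceSum T c d)ᗮ := by
      rw [eq_sub_of_add_eq (hsum.symm.trans hxv)]
      exact Submodule.sub_mem _ hv (Submodule.sub_mem _ (Submodule.smul_mem _ z hyE) hTy)
    have hn3 : z • (n : H) - T n = 0 :=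
      Submodule.disjoint_def.mp (Submodule.orthogonal_disjoint _) _ hn1 hn2
    have hn4 : (n : H) = 0 := by
      have : resolvent T z (z • (n : H) - T n) = n := (resolvent_spec hρ).1 n
      rw [← this, hn3, map_zero]
    rw [← hx, ← genResolvent_left hT (hunit (Metric.sphere_subset_closedBall hz)) (n + y), ← hxv]
    congr 1
    simp only [add_apply, smul_apply, hn.symm.trans hn4, one_apply_eq_self, smul_zero, add_zero]
  have h2 : DifferentiableOn ℂ (fun z : ℂ => genResolvent T (z • 1 + F) v)
      (Metric.closedBall (((c + d) / 2 : ℝ) : ℂ) ((d - c) / 2)) := fun z hz =>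
    ((differentiableAt_genResolvent (hunit hz)).clm_apply
      (differentiableAt_const v)).differentiableWithinAt
  rw [spectralProj_apply hT hcd.le hadm.left hadm.right, h1,
    Complex.circleIntegral_eq_zero_of_differentiable_on_off_countable (by linarith)
      countable_empty h2.continuousOn, smul_zero]
  intro z hz
  exact h2.differentiableAt (Metric.closedBall_mem_nhds_of_mem hz.1)

/-- The contour integral is the orthogonal projection onto the sum of the eigenspaces. -/
theorem spectralProj_eq_starProjection {c d : ℝ} (hcd : c < d) (hadm : IsAdmissible T c d)
    [(eigenspaceSum T c d).HasOrthogonalProjection] :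
    spectralProj T c d = (eigenspaceSum T c d).starProjection := by
  have hfix : eigenspaceSum T c d ≤ LinearMap.eqLocus (spectralProj T c d).toLinearMap .id :=
    iSup₂_le fun μ hμ v hv =>
      spectralProj_apply_of_mem_eigenspace hT hadm.left hadm.right hμ hv
  ext v
  have h1 : spectralProj T c d ((eigenspaceSum T c d).starProjection v) = _ :=
    hfix (Submodule.starProjection_apply_mem _ v)
  have h2 := spectralProj_apply_of_mem_orthogonal hT hcd hadm
    (Submodule.sub_starProjection_mem_orthogonal v)
  rw [map_sub, h1, sub_eq_zero] at h2
  exact h2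

theorem range_spectralProj {c d : ℝ} (hcd : c < d) (hadm : IsAdmissible T c d) :
    LinearMap.range (spectralProj T c d).toLinearMap = eigenspaceSum T c d := by
  have := finiteDimensional_eigenspaceSum hT hadm.disj
  rw [spectralProj_eq_starProjection hT hcd hadm]
  exact Submodule.range_starProjection _

theorem finrank_eigenspaceSum_add {a b c : ℝ} (hab : a ≤ b) (hbc : b ≤ c)
    (hb : (b : ℂ) ∈ resolventSet T) (hF : ∀ μ ∈ Icc a c, (μ : ℂ) ∉ essSpectrum T) :
    Module.finrank ℂ (eigenspaceSum T a c) =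
      Module.finrank ℂ (eigenspaceSum T a b) + Module.finrank ℂ (eigenspaceSum T b c) := by
  have := finiteDimensional_eigenspaceSum hT (c := a) (d := b) fun μ hμ =>
    hF μ ⟨hμ.1, hμ.2.trans hbc⟩
  have := finiteDimensional_eigenspaceSum hT (c := b) (d := c) fun μ hμ =>
    hF μ ⟨hab.trans hμ.1, hμ.2⟩
  have hsup : eigenspaceSum T a b ⊔ eigenspaceSum T b c = eigenspaceSum T a c := by
    refine le_antisymm (sup_le ?_ ?_) ?_
    · exact biSup_mono fun μ hμ => ⟨hμ.1, hμ.2.trans hbc⟩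
    · exact biSup_mono fun μ hμ => ⟨hab.trans hμ.1, hμ.2⟩
    · refine iSup₂_le fun μ hμ => ?_
      rcases le_total μ b with h | h
      · exact le_sup_of_le_left (eigenspace_le_eigenspaceSum T ⟨hμ.1, h⟩)
      · exact le_sup_of_le_right (eigenspace_le_eigenspaceSum T ⟨h, hμ.2⟩)
  have horth : eigenspaceSum T a b ⟂ eigenspaceSum T b c := by
    simp only [eigenspaceSum, Submodule.isOrtho_iSup_left, Submodule.isOrtho_iSup_right]
    intro ν hν μ hμ
    by_cases h : μ = ν
    · obtain rfl : μ = b := le_antisymm hμ.2 (h ▸ hν.1)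
      rw [eigenspace_eq_bot_of_mem_resolventSet hb]
      exact Submodule.isOrtho_bot_left
    · exact eigenspace_isOrtho hT h
  have h := Submodule.finrank_sup_add_finrank_inf_eq (eigenspaceSum T a b) (eigenspaceSum T b c)
  rwa [hsup, horth.disjoint.eq_bot, finrank_bot, add_zero] at h

end SpectralProjection

section Continuity

variable {H : Type*} [NormedAddCommGroup H] [InnerProductSpace ℂ H]

theorem finrank_le_of_norm_starProjection_sub_lt_one {E F : Submodule ℂ H}
    [FiniteDimensional ℂ E] [FiniteDimensional ℂ F]
    (h : ‖E.starProjection - F.starProjection‖ < 1) :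
    Module.finrank ℂ E ≤ Module.finrank ℂ F := by
  let f : E →ₗ[ℂ] F := F.orthogonalProjectionOnto.toLinearMap ∘ₗ E.subtype
  refine LinearMap.finrank_le_finrank_of_injective (f := f) ?_
  rw [← LinearMap.ker_eq_bot, LinearMap.ker_eq_bot']
  intro x hx
  have h1 : F.starProjection (x : H) = 0 := congrArg Subtype.val hx
  have h2 : E.starProjection (x : H) = x := Submodule.starProjection_eq_self_iff.mpr x.2
  have h3 := (E.starProjection - F.starProjection).le_opNorm (x : H)
  rw [sub_apply, h1, h2, sub_zero] at h3
  by_contra hne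
  have h4 : 0 < ‖(x : H)‖ := norm_pos_iff.mpr fun h0 => hne (Subtype.ext h0)
  nlinarith

variable [CompleteSpace H]

theorem continuous_resolvent_neg_I :
    Continuous fun T : SelfAdjointOp H => resolvent T.op (-I) := by
  have h1 : Continuous fun T : SelfAdjointOp H => cayley T.op :=
    (Isometry.of_dist_eq fun _ _ => rfl : Isometry fun T : SelfAdjointOp H => cayley T.op).continuous
  have h2 : (fun T : SelfAdjointOp H => resolvent T.op (-I)) =
      fun T => (2 * I : ℂ)⁻¹ • (cayley T.op - 1) := by
    funext T
    rw [cayley, add_sub_cancel_left, inv_smul_smul₀ (by simp)]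
  rw [h2]
  fun_prop

theorem continuous_pencil :
    Continuous fun p : (H →L[ℂ] H) × SelfAdjointOp H => pencil p.2.op p.1 := by
  have := (continuous_resolvent_neg_I (H := H)).comp
    (continuous_snd : Continuous fun p : (H →L[ℂ] H) × SelfAdjointOp H => p.2)
  unfold pencil
  exact continuous_const.add ((continuous_fst.add continuous_const).mul this)

theorem isOpen_isUnit_pencil :
    IsOpen {p : (H →L[ℂ] H) × SelfAdjointOp H | IsUnit (pencil p.2.op p.1)} :=
  Units.isOpen.preimage continuous_pencil

theorem continuousAt_genResolvent {p : (H →L[ℂ] H) × SelfAdjointOp H}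
    (hp : IsUnit (pencil p.2.op p.1)) :
    ContinuousAt (fun p : (H →L[ℂ] H) × SelfAdjointOp H => genResolvent p.2.op p.1) p := by
  have h1 := (continuous_resolvent_neg_I (H := H)).comp
    (continuous_snd : Continuous fun p : (H →L[ℂ] H) × SelfAdjointOp H => p.2)
  have h2 : ContinuousAt Ring.inverse (pencil p.2.op p.1) := by
    obtain ⟨u, hu⟩ := hp
    rw [← hu]
    exact NormedRing.inverse_continuousAt u
  exact h1.continuousAt.mul
    (ContinuousAt.comp (f := fun p : (H →L[ℂ] H) × SelfAdjointOp H => pencil p.2.op p.1) h2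
      continuous_pencil.continuousAt)

theorem isOpen_mem_resolventSet :
    IsOpen {p : ℂ × SelfAdjointOp H | p.1 ∈ resolventSet p.2.op} := by
  have h : Continuous fun p : ℂ × SelfAdjointOp H => (p.1 • (1 : H →L[ℂ] H), p.2) := by fun_prop
  convert isOpen_isUnit_pencil.preimage h using 1
  ext p
  exact mem_resolventSet_iff_isUnit p.2.isSelfAdjoint

theorem continuousOn_resolvent_prod :
    ContinuousOn (fun p : ℂ × SelfAdjointOp H => resolvent p.2.op p.1)
      {p | p.1 ∈ resolventSet p.2.op} := by
  have h : Continuous fun p : ℂ × SelfAdjointOp H => (p.1 • (1 : H →L[ℂ] H), p.2) := by fun_prop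
  have h1 : ContinuousOn (fun p : ℂ × SelfAdjointOp H => genResolvent p.2.op (p.1 • 1))
      {p | p.1 ∈ resolventSet p.2.op} := fun p hp =>
    (ContinuousAt.comp (f := fun p : ℂ × SelfAdjointOp H => (p.1 • (1 : H →L[ℂ] H), p.2))
      (continuousAt_genResolvent ((mem_resolventSet_iff_isUnit p.2.isSelfAdjoint).mp hp))
      h.continuousAt).continuousWithinAt
  exact h1.congr fun p hp => resolvent_eq_genResolvent p.2.isSelfAdjoint
    ((mem_resolventSet_iff_isUnit p.2.isSelfAdjoint).mp hp)

theorem isOpen_notMem_essSpectrum :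
    IsOpen {p : ℝ × SelfAdjointOp H | (p.1 : ℂ) ∉ essSpectrum p.2.op} := by
  rw [isOpen_iff_mem_nhds]
  rintro ⟨μ, T⟩ hp
  obtain ⟨F, hF, hunit⟩ := exists_isUnit_of_isFredholm T.isSelfAdjoint (notMem_essSpectrum.mp hp)
  have h : Continuous fun p : ℝ × SelfAdjointOp H =>
      ((p.1 : ℂ) • (1 : H →L[ℂ] H) + F, p.2) := by fun_prop
  filter_upwards [(isOpen_isUnit_pencil.preimage h).mem_nhds hunit] with q hq
  exact notMem_essSpectrum.mpr (isFredholm_of_isUnit q.2.isSelfAdjoint hq hF)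

theorem eventually_mem_resolventSet {T : SelfAdjointOp H} {z : ℂ} (hz : z ∈ resolventSet T.op) :
    ∀ᶠ S in 𝓝 T, z ∈ resolventSet S.op :=
  (isOpen_mem_resolventSet.preimage (Continuous.prodMk_right z)).mem_nhds hz

theorem IsAdmissible.eventually {T : SelfAdjointOp H} {c d : ℝ} (h : IsAdmissible T.op c d) :
    ∀ᶠ S : SelfAdjointOp H in 𝓝 T, IsAdmissible S.op c d := by
  have h1 : ∀ᶠ S in 𝓝 T, ∀ μ ∈ Icc c d, (μ : ℂ) ∉ essSpectrum S.op := by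
    refine isCompact_Icc.eventually_forall_of_forall_eventually fun μ hμ => ?_
    exact (isOpen_notMem_essSpectrum.preimage continuous_swap).mem_nhds (h.disj μ hμ)
  filter_upwards [h1, eventually_mem_resolventSet h.left, eventually_mem_resolventSet h.right]
    with S h1 h2 h3 using ⟨h2, h3, h1⟩

theorem continuousOn_spectralProj {c d : ℝ} (hcd : c ≤ d) :
    ContinuousOn (fun T : SelfAdjointOp H => spectralProj T.op c d)
      {T | IsAdmissible T.op c d} := by
  rw [continuousOn_iff_continuous_domRestrict]
  refine Continuous.const_smul ?_ (2 * Real.pi * I : ℂ)⁻¹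
  refine intervalIntegral.continuous_parametric_intervalIntegral_of_continuous' ?_ _ _
  have hR : 0 ≤ (d - c) / 2 := by linarith
  have h1 : Continuous fun p : {T : SelfAdjointOp H | IsAdmissible T.op c d} × ℝ =>
      deriv (circleMap (((c + d) / 2 : ℝ) : ℂ) ((d - c) / 2)) p.2 := by
    simp only [deriv_circleMap]
    fun_prop
  have h2 : Continuous fun p : {T : SelfAdjointOp H | IsAdmissible T.op c d} × ℝ =>
      resolvent p.1.1.op (circleMap (((c + d) / 2 : ℝ) : ℂ) ((d - c) / 2) p.2) :=
    continuousOn_resolvent_prod.comp_continuous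
      (f := fun p : {T : SelfAdjointOp H | IsAdmissible T.op c d} × ℝ =>
        (circleMap (((c + d) / 2 : ℝ) : ℂ) ((d - c) / 2) p.2, (p.1 : SelfAdjointOp H)))
      (by fun_prop) fun p => sphere_subset_resolventSet p.1.1.isSelfAdjoint p.1.2.left
        p.1.2.right (circleMap_mem_sphere _ hR _)
  exact h1.smul h2

theorem IsAdmissible.eventually_finrank_eq {T : SelfAdjointOp H} {c d : ℝ} (hcd : c < d)
    (h : IsAdmissible T.op c d) :
    ∀ᶠ S : SelfAdjointOp H in 𝓝 T, Module.finrank ℂ (eigenspaceSum S.op c d) =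
      Module.finrank ℂ (eigenspaceSum T.op c d) := by
  have h1 : ContinuousAt (fun T : SelfAdjointOp H => spectralProj T.op c d) T :=
    (continuousOn_spectralProj hcd.le).continuousAt h.eventually
  filter_upwards [h.eventually, h1.eventually (Metric.ball_mem_nhds _ one_pos)] with S hS hST
  have := finiteDimensional_eigenspaceSum T.isSelfAdjoint h.disj
  have := finiteDimensional_eigenspaceSum S.isSelfAdjoint hS.disj
  rw [dist_eq_norm, spectralProj_eq_starProjection T.isSelfAdjoint hcd h,
    spectralProj_eq_starProjection S.isSelfAdjoint hcd hS] at hST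
  exact le_antisymm (finrank_le_of_norm_starProjection_sub_lt_one hST)
    (finrank_le_of_norm_starProjection_sub_lt_one (by rwa [norm_sub_rev]))

/-- The dimension of `E_{[0,a]}(T)`. -/
def eigenCount (T : SelfAdjointOp H) (a : ℝ) : ℤ :=
  Module.finrank ℂ (eigenspaceSum T.op 0 a)

theorem eventually_eigenCount_sub {T : SelfAdjointOp H} {a b : ℝ} (ha : 0 < a) (hb : 0 < b)
    (hTa : IsAdmissible T.op (-a) a) (hTb : IsAdmissible T.op (-b) b) :
    ∀ᶠ S in 𝓝 T, eigenCount S a - eigenCount S b = eigenCount T a - eigenCount T b := by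
  wlog hab : a ≤ b generalizing a b
  · filter_upwards [this hb ha hTb hTa (le_of_not_ge hab)] with S hS
    linarith
  rcases hab.eq_or_lt with rfl | hab
  · simp
  have key : ∀ S : SelfAdjointOp H, IsAdmissible S.op (-a) a → IsAdmissible S.op (-b) b →
      eigenCount S b = eigenCount S a + Module.finrank ℂ (eigenspaceSum S.op a b) := by
    intro S hSa hSb
    have := finrank_eigenspaceSum_add S.isSelfAdjoint ha.le hab.le hSa.right
      fun μ hμ => hSb.disj μ ⟨by linarith [hμ.1], hμ.2⟩
    unfold eigenCount
    exact_mod_cast this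
  have hadm : IsAdmissible T.op a b :=
    ⟨hTa.right, hTb.right, fun μ hμ => hTb.disj μ ⟨by linarith [hμ.1], hμ.2⟩⟩
  filter_upwards [hTa.eventually, hTb.eventually, hadm.eventually_finrank_eq hab]
    with S hSa hSb hS
  rw [key S hSa hSb, key T hTa hTb, hS]
  ring

theorem eventually_eigenCount_eq {T : SelfAdjointOp H} {a : ℝ} (ha : 0 < a)
    (hTa : IsAdmissible T.op (-a) a) (h0 : (0 : ℂ) ∈ resolventSet T.op) :
    ∀ᶠ S in 𝓝 T, eigenCount S a = eigenCount T a := by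
  have hadm : IsAdmissible T.op 0 a :=
    ⟨by simpa using h0, hTa.right, fun μ hμ => hTa.disj μ ⟨by linarith [hμ.1], hμ.2⟩⟩
  filter_upwards [hadm.eventually_finrank_eq ha] with S hS
  unfold eigenCount
  rw [hS]

theorem exists_isAdmissible {T : H →ₗ.[ℂ] H} (hT : IsSelfAdjoint T) (hF : IsFredholm T) :
    ∃ a > 0, IsAdmissible T (-a) a := by
  have hF0 : IsFredholm (scalarSub ((0 : ℝ) : ℂ) T) := by
    simpa using hF.scalarSub_zero hT
  obtain ⟨ε, hε, h⟩ := hF0.eventually_mem_resolventSet hT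
  refine ⟨ε / 2, half_pos hε, h _ (by linarith) ?_, h _ (by linarith) ?_, fun μ hμ => ?_⟩
  · rw [sub_zero, abs_neg, abs_of_pos (half_pos hε)]
    linarith
  · rw [sub_zero, abs_of_pos (half_pos hε)]
    linarith
  · rw [notMem_essSpectrum]
    rcases eq_or_ne μ 0 with rfl | h0
    · exact hF0
    · refine isFredholm_of_mem_resolventSet hT (h μ h0 ?_)
      rw [sub_zero, abs_lt]
      constructor <;> linarith [hμ.1, hμ.2]

theorem IsInvertible.zero_mem_resolventSet {T : H →ₗ.[ℂ] H} (hT : IsSelfAdjoint T)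
    (hF : IsFredholm T) (hinv : IsInvertible T) : (0 : ℂ) ∈ resolventSet T := by
  have hF0 : IsFredholm (scalarSub ((0 : ℝ) : ℂ) T) := by
    simpa using hF.scalarSub_zero hT
  have h := mem_resolventSet_of_eigenspace_eq_bot hT hF0 <| by
    rw [Submodule.eq_bot_iff]
    intro v hv
    obtain ⟨x, rfl, hx⟩ := mem_eigenspace.mp hv
    have : T x = T 0 := by rw [hx, LinearPMap.map_zero]; simp
    rw [hinv.1 this]
    rfl
  simpa using h

end Continuity

section Telescoping

theorem sum_fin_succ_sub_castSucc {n : ℕ} (u : Fin (n + 1) → ℤ) :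
    ∑ i : Fin n, (u i.succ - u i.castSucc) = u (Fin.last n) - u 0 := by
  have h := (Fin.sum_univ_succ u).symm.trans (Fin.sum_univ_castSucc u)
  rw [Finset.sum_sub_distrib]
  linarith

theorem sum_fin_eq_zero_of_glue {m : ℕ} (d : Fin (m + 1) → Fin (m + 2) → ℤ) (h0 : d 0 0 = 0)
    (hlast : d (Fin.last m) (Fin.last (m + 1)) = 0)
    (hglue : ∀ j : Fin m, d j.castSucc j.castSucc.succ = d j.succ j.succ.castSucc) :
    ∑ i : Fin (m + 1), (d i i.succ - d i i.castSucc) = 0 := by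
  rw [Finset.sum_sub_distrib, Fin.sum_univ_castSucc, Fin.sum_univ_succ (fun i => d i i.castSucc),
    Fin.castSucc_zero, h0, Fin.succ_last, hlast, Finset.sum_congr rfl fun j _ => hglue j]
  ring

end Telescoping

section Flow

variable {H : Type*} [NormedAddCommGroup H] [InnerProductSpace ℂ H] [CompleteSpace H]

/-- The sum defining the spectral flow, for a given partition. -/
def flowSum (A : unitInterval → FredholmSelfAdjointOp H) {n : ℕ}
    (t : Fin (n + 1) → unitInterval) (a : Fin n → ℝ) : ℤ :=
  ∑ i : Fin n, (eigenCount (A (t i.succ)).1 (a i) - eigenCount (A (t i.castSucc)).1 (a i))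

variable {A : unitInterval → FredholmSelfAdjointOp H} {n : ℕ} {t : Fin (n + 1) → unitInterval}
  {a : Fin n → ℝ}

theorem IsFlowPartition.isAdmissible (hP : IsFlowPartition A t a) (i : Fin n) (s : unitInterval)
    (hs : s ∈ Icc (t i.castSucc) (t i.succ)) : IsAdmissible (A s).1.op (-(a i)) (a i) :=
  ⟨hP.left_mem i s hs, hP.right_mem i s hs, hP.disj i s hs⟩

theorem isFlowPartition_of_isAdmissible (hA : Continuous A) (mono : Monotone t) (zero : t 0 = 0)
    (last : t (Fin.last n) = 1) (pos : ∀ i, 0 < a i)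
    (hadm : ∀ i, ∀ s ∈ Icc (t i.castSucc) (t i.succ), IsAdmissible (A s).1.op (-(a i)) (a i)) :
    IsFlowPartition A t a := by
  have hA' : Continuous fun s => (A s).1 := continuous_subtype_val.comp hA
  have hlt : ∀ i, -(a i) < a i := fun i => by linarith [pos i]
  refine ⟨mono, zero, last, pos, fun i s hs => (hadm i s hs).right,
    fun i s hs => (hadm i s hs).left, fun i s hs => (hadm i s hs).disj, fun i => ?_,
    fun i s hs => ?_, fun i s hs s' hs' => ?_⟩
  · exact (continuousOn_spectralProj (hlt i).le).comp (f := fun s => (A s).1) hA'.continuousOn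
      (hadm i)
  · rw [range_spectralProj (A s).1.isSelfAdjoint (hlt i) (hadm i s hs)]
    exact finiteDimensional_eigenspaceSum (A s).1.isSelfAdjoint (hadm i s hs).disj
  · rw [range_spectralProj (A s).1.isSelfAdjoint (hlt i) (hadm i s hs),
      range_spectralProj (A s').1.isSelfAdjoint (hlt i) (hadm i s' hs')]
    refine isPreconnected_Icc.constant
      (f := fun s => Module.finrank ℂ (eigenspaceSum (A s).1.op (-(a i)) (a i)))
      (fun r hr => ContinuousAt.continuousWithinAt ?_) hs hs'
    exact (continuousAt_const (y := Module.finrank ℂ (eigenspaceSum (A r).1.op (-(a i)) (a i)))).congr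
      ((hA'.continuousAt.eventually ((hadm i r hr).eventually_finrank_eq (hlt i))).mono
        fun _ h => h.symm)

theorem exists_isFlowPartition (hA : Continuous A) :
    ∃ (n : ℕ) (t : Fin (n + 1) → unitInterval) (a : Fin n → ℝ), IsFlowPartition A t a := by
  have hA' : Continuous fun s => (A s).1 := continuous_subtype_val.comp hA
  have hex : ∀ s, ∃ a > 0, IsAdmissible (A s).1.op (-a) a := fun s =>
    exists_isAdmissible (A s).1.isSelfAdjoint (A s).2
  choose b hb hadm using hex
  let c : unitInterval → Set unitInterval := fun s =>
    interior {r | IsAdmissible (A r).1.op (-(b s)) (b s)}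
  obtain ⟨t, ht0, htm, ⟨n, hn⟩, hsub⟩ := exists_monotone_Icc_subset_open_cover_unitInterval
    (c := c) (fun _ => isOpen_interior) fun s _ => mem_iUnion.mpr
      ⟨s, mem_interior_iff_mem_nhds.mpr (hA'.continuousAt.eventually (hadm s).eventually)⟩
  choose idx hidx using hsub
  refine ⟨n, fun k => t k, fun i => b (idx i), isFlowPartition_of_isAdmissible hA
    (fun i j hij => htm hij) ht0 (hn n le_rfl) (fun i => hb _) fun i s hs => ?_⟩
  exact interior_subset (s := {r | IsAdmissible (A r).1.op (-(b (idx i))) (b (idx i))}) (hidx i hs)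

theorem eventually_comp_min {ψ : unitInterval → ℤ} {s : unitInterval}
    (h : ∀ᶠ r in 𝓝 s, ψ r = ψ s) (p : unitInterval) :
    ∀ᶠ r in 𝓝 s, ψ (min p r) = ψ (min p s) := by
  rcases lt_or_ge p s with hp | hp
  · filter_upwards [lt_mem_nhds hp] with r hr
    rw [min_eq_left hr.le, min_eq_left hp.le]
  · have h1 : Tendsto (fun r => min p r) (𝓝 s) (𝓝 s) := by
      have : Continuous fun r => min p r := by fun_prop
      simpa [min_eq_right hp] using this.tendsto s
    rw [min_eq_right hp]
    exact h1.eventually h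

/-- The flow of the path up to time `s`, computed with a given partition. -/
def partialFlow (A : unitInterval → FredholmSelfAdjointOp H) {n : ℕ}
    (t : Fin (n + 1) → unitInterval) (a : Fin n → ℝ) (s : unitInterval) : ℤ :=
  flowSum A (fun k => min (t k) s) a

theorem IsFlowPartition.eventually_partialFlow_sub (hA : Continuous A)
    (hP : IsFlowPartition A t a) {s : unitInterval} {b : ℝ} (hb : 0 < b)
    (hadm : IsAdmissible (A s).1.op (-b) b) :
    ∀ᶠ r in 𝓝 s, partialFlow A t a r - eigenCount (A r).1 b =
      partialFlow A t a s - eigenCount (A s).1 b := by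
  have hA' : Continuous fun s => (A s).1 := continuous_subtype_val.comp hA
  let ψ : Fin n → unitInterval → ℤ := fun i r =>
    eigenCount (A r).1 (a i) - eigenCount (A r).1 b
  have hterm : ∀ᶠ r in 𝓝 s, ∀ i : Fin n, ψ i (min (t i.succ) r) - ψ i (min (t i.castSucc) r) =
      ψ i (min (t i.succ) s) - ψ i (min (t i.castSucc) s) := by
    refine eventually_all.mpr fun i => ?_
    have hle : t i.castSucc ≤ t i.succ := hP.mono i.castSucc_le_succ
    rcases lt_or_ge s (t i.castSucc) with h1 | h1
    · filter_upwards [gt_mem_nhds h1] with r hr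
      rw [min_eq_right hr.le, min_eq_right (hr.le.trans hle), min_eq_right h1.le,
        min_eq_right (h1.le.trans hle), sub_self, sub_self]
    rcases lt_or_ge (t i.succ) s with h2 | h2
    · filter_upwards [lt_mem_nhds h2] with r hr
      rw [min_eq_left hr.le, min_eq_left (hle.trans hr.le), min_eq_left h2.le, min_eq_left h1]
    have hψ : ∀ᶠ r in 𝓝 s, ψ i r = ψ i s := hA'.continuousAt.eventually
      (eventually_eigenCount_sub (hP.pos i) hb (hP.isAdmissible i s ⟨h1, h2⟩) hadm)
    filter_upwards [eventually_comp_min hψ (t i.succ), eventually_comp_min hψ (t i.castSucc)]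
      with r h3 h4
    rw [h3, h4]
  have hsum : ∀ r, ∑ i, (ψ i (min (t i.succ) r) - ψ i (min (t i.castSucc) r)) =
      partialFlow A t a r - eigenCount (A r).1 b + eigenCount (A 0).1 b := by
    intro r
    have h1 := sum_fin_succ_sub_castSucc fun k => eigenCount (A (min (t k) r)).1 b
    rw [hP.last, hP.zero, min_eq_right unitInterval.le_one', min_eq_left unitInterval.nonneg'] at h1
    have h2 : partialFlow A t a r - eigenCount (A r).1 b + eigenCount (A 0).1 b =
      partialFlow A t a r - (eigenCount (A r).1 b - eigenCount (A 0).1 b) := by ring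
    rw [h2, ← h1, partialFlow, flowSum, ← Finset.sum_sub_distrib]
    exact Finset.sum_congr rfl fun i _ => by simp only [ψ]; ring
  filter_upwards [hterm] with r hr
  have h1 := (hsum r).symm.trans ((Finset.sum_congr rfl fun i _ => hr i).trans (hsum s))
  linarith

theorem partialFlow_zero : partialFlow A t a 0 = 0 := by
  simp [partialFlow, flowSum]

theorem partialFlow_one : partialFlow A t a 1 = flowSum A t a := by
  simp only [partialFlow, min_eq_left unitInterval.le_one']

theorem IsFlowPartition.flowSum_eq (hA : Continuous A) (hP : IsFlowPartition A t a) {n' : ℕ}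
    {t' : Fin (n' + 1) → unitInterval} {a' : Fin n' → ℝ} (hP' : IsFlowPartition A t' a') :
    flowSum A t a = flowSum A t' a' := by
  have h := isPreconnected_univ.constant
    (f := fun s => partialFlow A t a s - partialFlow A t' a' s)
    (fun s _ => ContinuousAt.continuousWithinAt ?_) (mem_univ 1) (mem_univ 0)
  · simp only [partialFlow_zero, partialFlow_one, sub_self] at h
    exact sub_eq_zero.mp h
  · obtain ⟨b, hb, hadm⟩ := exists_isAdmissible (A s).1.isSelfAdjoint (A s).2
    refine (continuousAt_const (y := partialFlow A t a s - partialFlow A t' a' s)).congr ?_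
    filter_upwards [hP.eventually_partialFlow_sub hA hb hadm,
      hP'.eventually_partialFlow_sub hA hb hadm] with r h1 h2
    linarith

theorem existsUnique_hasSpectralFlow (hA : Continuous A) : ∃! k : ℤ, HasSpectralFlow A k := by
  obtain ⟨n, t, a, hP⟩ := exists_isFlowPartition hA
  refine ⟨flowSum A t a, ⟨n, t, a, hP, rfl⟩, ?_⟩
  rintro k ⟨n', t', a', hP', rfl⟩
  exact hP'.flowSum_eq hA hP

theorem IsFlowPartition.spectralFlow_eq (hA : Continuous A) (hP : IsFlowPartition A t a) :
    spectralFlow A = flowSum A t a := by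
  have h : ∃ k, HasSpectralFlow A k := ⟨_, n, t, a, hP, rfl⟩
  rw [spectralFlow, dif_pos h]
  exact (existsUnique_hasSpectralFlow hA).unique h.choose_spec ⟨n, t, a, hP, rfl⟩

variable {h : unitInterval × unitInterval → FredholmSelfAdjointOp H}

theorem eventually_isFlowPartition (hcont : Continuous h) {s : unitInterval}
    (hP : IsFlowPartition (fun r => h (s, r)) t a) :
    ∀ᶠ s' in 𝓝 s, IsFlowPartition (fun r => h (s', r)) t a := by
  have hcont' : Continuous fun p => (h p).1 := continuous_subtype_val.comp hcont
  have hadm : ∀ᶠ s' in 𝓝 s, ∀ i : Fin n, ∀ r ∈ Icc (t i.castSucc) (t i.succ),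
      IsAdmissible (h (s', r)).1.op (-(a i)) (a i) :=
    eventually_all.mpr fun i => isCompact_Icc.eventually_forall_of_forall_eventually fun r hr =>
      hcont'.continuousAt.eventually (hP.isAdmissible i r hr).eventually
  filter_upwards [hadm] with s' hs'
  exact isFlowPartition_of_isAdmissible (hcont.comp (Continuous.prodMk_right s')) hP.mono hP.zero
    hP.last hP.pos hs'

theorem eventually_flowSum_eq (hcont : Continuous h) (hinv₀ : ∀ s, IsInvertible (h (s, 0)).1.op)
    (hinv₁ : ∀ s, IsInvertible (h (s, 1)).1.op) {s : unitInterval}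
    (hP : IsFlowPartition (fun r => h (s, r)) t a) :
    ∀ᶠ s' in 𝓝 s, flowSum (fun r => h (s', r)) t a = flowSum (fun r => h (s, r)) t a := by
  have htend : ∀ r, ContinuousAt (fun s' => (h (s', r)).1) s := fun r =>
    (continuous_subtype_val.comp (hcont.comp (Continuous.prodMk_left r))).continuousAt
  obtain _ | m := n
  · exact absurd (hP.zero.symm.trans hP.last) zero_ne_one
  have hleft : ∀ i, IsAdmissible (h (s, t i.castSucc)).1.op (-(a i)) (a i) := fun i =>
    hP.isAdmissible i _ ⟨le_rfl, hP.mono i.castSucc_le_succ⟩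
  have hright : ∀ i, IsAdmissible (h (s, t i.succ)).1.op (-(a i)) (a i) := fun i =>
    hP.isAdmissible i _ ⟨hP.mono i.castSucc_le_succ, le_rfl⟩
  have h0 : ∀ᶠ s' in 𝓝 s,
      eigenCount (h (s', t 0)).1 (a 0) = eigenCount (h (s, t 0)).1 (a 0) := by
    refine (htend _).eventually (eventually_eigenCount_eq (hP.pos 0) (hleft 0) ?_)
    change (0 : ℂ) ∈ resolventSet (h (s, t 0)).1.op
    rw [hP.zero]
    exact (hinv₀ s).zero_mem_resolventSet (h (s, 0)).1.isSelfAdjoint (h (s, 0)).2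
  have h1 : ∀ᶠ s' in 𝓝 s, eigenCount (h (s', t (Fin.last (m + 1)))).1 (a (Fin.last m)) =
      eigenCount (h (s, t (Fin.last (m + 1)))).1 (a (Fin.last m)) := by
    refine (htend _).eventually (eventually_eigenCount_eq (hP.pos _) (hright (Fin.last m)) ?_)
    change (0 : ℂ) ∈ resolventSet (h (s, t (Fin.last (m + 1)))).1.op
    rw [hP.last]
    exact (hinv₁ s).zero_mem_resolventSet (h (s, 1)).1.isSelfAdjoint (h (s, 1)).2
  have hglue : ∀ᶠ s' in 𝓝 s, ∀ j : Fin m,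
      eigenCount (h (s', t j.castSucc.succ)).1 (a j.castSucc) -
        eigenCount (h (s', t j.castSucc.succ)).1 (a j.succ) =
      eigenCount (h (s, t j.castSucc.succ)).1 (a j.castSucc) -
        eigenCount (h (s, t j.castSucc.succ)).1 (a j.succ) :=
    eventually_all.mpr fun j => (htend _).eventually
      (eventually_eigenCount_sub (hP.pos _) (hP.pos _) (hright j.castSucc) (hleft j.succ))
  filter_upwards [h0, h1, hglue] with s' h0 h1 hglue
  have := sum_fin_eq_zero_of_glue (fun i k =>
    eigenCount (h (s', t k)).1 (a i) - eigenCount (h (s, t k)).1 (a i))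
    (sub_eq_zero.mpr h0) (sub_eq_zero.mpr h1) fun j => by
      have := hglue j
      rw [Fin.succ_castSucc] at this ⊢
      linarith
  rw [← sub_eq_zero, ← this, flowSum, flowSum, ← Finset.sum_sub_distrib]
  exact Finset.sum_congr rfl fun i _ => by ring

end Flow

end

end SpecFlow

theorem mainTheorem2 {H : Type*} [NormedAddCommGroup H] [InnerProductSpace ℂ H] [CompleteSpace H]
    (h : unitInterval × unitInterval → SpecFlow.FredholmSelfAdjointOp H)
    (hcont : Continuous h)
    (hinv₀ : ∀ s : unitInterval, SpecFlow.IsInvertible (h (s, 0)).1.op)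
    (hinv₁ : ∀ s : unitInterval, SpecFlow.IsInvertible (h (s, 1)).1.op) :
    (∃! k : ℤ, SpecFlow.HasSpectralFlow (fun t => h (0, t)) k) ∧
    (∃! k : ℤ, SpecFlow.HasSpectralFlow (fun t => h (1, t)) k) ∧
    SpecFlow.spectralFlow (fun t => h (0, t)) = SpecFlow.spectralFlow (fun t => h (1, t)) := by
  have hpath : ∀ s, Continuous fun t => h (s, t) := fun s => hcont.comp (Continuous.prodMk_right s)
  refine ⟨SpecFlow.existsUnique_hasSpectralFlow (hpath 0),
    SpecFlow.existsUnique_hasSpectralFlow (hpath 1), ?_⟩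
  refine isPreconnected_univ.constant (f := fun s => SpecFlow.spectralFlow fun t => h (s, t))
    (fun s _ => ContinuousAt.continuousWithinAt ?_) (Set.mem_univ 0) (Set.mem_univ 1)
  obtain ⟨n, t, a, hP⟩ := SpecFlow.exists_isFlowPartition (hpath s)
  refine (continuousAt_const (y := SpecFlow.spectralFlow fun t => h (s, t))).congr ?_
  filter_upwards [SpecFlow.eventually_isFlowPartition hcont hP,
    SpecFlow.eventually_flowSum_eq hcont hinv₀ hinv₁ hP] with s' hP' hs'
  rw [hP.spectralFlow_eq (hpath s), hP'.spectralFlow_eq (hpath s'), hs']
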